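/- Let $\Omega\subseteq\mathbb{R}^d$ be open, let $f_1,\dots,f_\kappa:\Omega\to\mathbb{R}$ be real-analytic, let $A_1,\dots,A_\kappa\in\mathbb{C}^{n\times n}$, put $A(x)=\sum_{i=1}^{\kappa} f_i(x)A_i$, and let $\epsilon>0$. For $x\in\Omega$ and $z=(z_1,z_2)\in\mathbb{R}^2$ (identified with $z_1+\mathrm{i}z_2\in\mathbb{C}$) let $\sigma(x,z)$ be the smallest singular value of $A(x)-(z_1+\mathrm{i}z_2)I$, let $\Lambda_\epsilon(x)=\{z : \sigma(x,z)\le\epsilon\}$ be the $\epsilon$-pseudospectrum of $A(x)$, and let $$\alpha_\epsilon(x)=\max\{z_1 : z\in\Lambda_\epsilon(x)\}$$ be its $\epsilon$-pseudospectral abscissa. Write $y=(y_1,y_2,y_3)=(z_1,z_2,\mu)$ and let $\mathcal{L}(x,y)=z_1-\mu(\sigma(x,z)-\epsilon)$ be the Lagrangian of this maximization problem. A Lagrange multiplier at an optimal $z$ is a real $\mu\ge 0$ with $\mathcal{L}_{z_1}(x,z,\mu)=\mathcal{L}_{z_2}(x,z,\mu)=0$ and $\mu(\sigma(x,z)-\epsilon)=0$.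 Let $\nabla^2_{xx}\mathcal{L}$, $\nabla^2_{xy}\mathcal{L}$, $\nabla^2_{yy}\mathcal{L}$ denote the $d\times d$, $d\times 3$, $3\times 3$ matrices of second partial derivatives of $\mathcal{L}$. A point $x\in\Omega$ is called nondegenerate if (i) the maximization problem has a unique optimal point $z(x)$; (ii) $\sigma(x,z(x))$ is a simple singular value of $A(x)-z(x)I$; (iii) $\nabla^2_{yy}\mathcal{L}(x,y(x))$ is nonsingular, where $y(x)=(z(x),\mu(x))$ and $\mu(x)$ is the Lagrange multiplier at $z(x)$ (conditions (i) and (ii) imply that it exists and is unique). Let $\widetilde{x}\in\Omega$ be a nondegenerate point. Then the multiplier $\mu(\widetilde{x})$ exists and is unique, $\mathcal{L}$ is real-analytic at $(\widetilde{x},y(\widetilde{x}))$, and $x\mapsto\alpha_\epsilon(x)$ is real-analytic at $\widetilde{x}$. For every pair of consistent unit left and right singular vectors $u,v$ for $\sigma=\sigma(\widetilde{x},z(\widetilde{x}))$, that is, unit vectors with $(A(\widetilde{x})-z(\widetilde{x})I)v=\sigma u$ and $u^*(A(\widetilde{x})-z(\widetilde{x})I)=\sigma v^*$, one has $u^*v\neq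 0$, $$\nabla\alpha_\epsilon(\widetilde{x})=\left[\mathrm{Re}\left(\frac{u^*\left[\frac{\partial A}{\partial x_1}(\widetilde{x})\right]v}{u^*v}\right)\ \cdots\ \mathrm{Re}\left(\frac{u^*\left[\frac{\partial A}{\partial x_d}(\widetilde{x})\right]v}{u^*v}\right)\right]^T,\qquad \mu(\widetilde{x})=-\frac{1}{u^*v}.$$ Moreover, with all blocks evaluated at $(\widetilde{x},y(\widetilde{x}))$, $$\nabla^2\alpha_\epsilon(\widetilde{x})=\nabla^2_{xx}\mathcal{L}-\nabla^2_{xy}\mathcal{L}\,[\nabla^2_{yy}\mathcal{L}]^{-1}\,[\nabla^2_{xy}\mathcal{L}]^T,$$ where, with all derivatives taken at $\widetilde{x}$, $z(\widetilde{x})$, $\mu(\widetilde{x})$, $$[\nabla^2_{xx}\mathcal{L}]_{j\ell}=-\mu(\widetilde{x})\frac{\partial^2\sigma}{\partial x_j\partial x_\ell},\qquad [\nabla^2_{xy}\mathcal{L}]_{j\ell}=-\mu(\widetilde{x})\frac{\partial^2\sigma}{\partial x_j\partial z_\ell}\ (\ell=1,2),\qquad [\nabla^2_{xy}\mathcal{L}]_{j3}=-\frac{\partial\sigma}{\partial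 x_j},\qquad [\nabla^2_{yy}\mathcal{L}]_{j\ell}=-\frac{\partial^2[\mu\,\sigma(x,z)]}{\partial y_j\partial y_\ell}.$$ -/

import Mathlib

noncomputable section

namespace PsAbscissa

/-- The smallest singular value of an `n × n` complex matrix. (Mathlib lists the singular values
in decreasing order, with multiplicity, starting from index `0`.) -/
def sigmaMin {n : ℕ} (M : Matrix (Fin n) (Fin n) ℂ) : ℝ :=
  (Matrix.toEuclideanLin M).singularValues (n - 1)

/-- The smallest singular value of `M` is simple: it occurs exactly once among the `n` singular
values of `M`, counted with multiplicity. -/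
def SigmaMinSimple {n : ℕ} (M : Matrix (Fin n) (Fin n) ℂ) : Prop :=
  ∃! i : Fin n, (Matrix.toEuclideanLin M).singularValues i = sigmaMin M

/-- `u`, `v` are consistent unit left and right singular vectors of `M` for its smallest singular
value `σ`: `M v = σ u`, `u* M = σ v*`, `u* u = v* v = 1`. -/
def IsConsistentPair {n : ℕ} (M : Matrix (Fin n) (Fin n) ℂ) (u v : Fin n → ℂ) : Prop :=
  star u ⬝ᵥ u = 1 ∧ star v ⬝ᵥ v = 1 ∧
    Matrix.mulVec M v = (sigmaMin M : ℂ) • u ∧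
    Matrix.vecMul (star u) M = (sigmaMin M : ℂ) • star v

/-- The matrix-valued function `A(x) = f₁(x) A₁ + ⋯ + f_κ(x) A_κ`. -/
def matFun {d n κ : ℕ} (f : Fin κ → EuclideanSpace ℝ (Fin d) → ℝ)
    (As : Fin κ → Matrix (Fin n) (Fin n) ℂ) (x : EuclideanSpace ℝ (Fin d)) :
    Matrix (Fin n) (Fin n) ℂ :=
  ∑ i, (f i x : ℂ) • As i

/-- The (entrywise) partial derivative `∂A/∂x_j (x)` of a matrix-valued function. -/
def matPartial {d n : ℕ} (A : EuclideanSpace ℝ (Fin d) → Matrix (Fin n) (Fin n) ℂ) (j : Fin d)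
    (x : EuclideanSpace ℝ (Fin d)) : Matrix (Fin n) (Fin n) ℂ :=
  Matrix.of fun p q => lineDeriv ℝ (fun x' => A x' p q) x (EuclideanSpace.single j 1)

/-- `A(x, z) = A(x) - z I`. -/
def shifted {d n : ℕ} (A : EuclideanSpace ℝ (Fin d) → Matrix (Fin n) (Fin n) ℂ)
    (x : EuclideanSpace ℝ (Fin d)) (z : ℂ) : Matrix (Fin n) (Fin n) ℂ :=
  A x - z • (1 : Matrix (Fin n) (Fin n) ℂ)

/-- The `ε`-pseudospectrum `Λ_ε(x)` of `A(x)`. -/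
def pseudospectrum {d n : ℕ} (A : EuclideanSpace ℝ (Fin d) → Matrix (Fin n) (Fin n) ℂ) (ε : ℝ)
    (x : EuclideanSpace ℝ (Fin d)) : Set ℂ :=
  {z | sigmaMin (shifted A x z) ≤ ε}

/-- The `ε`-pseudospectral abscissa `α_ε(x)` of `A(x)`. -/
def abscissa {d n : ℕ} (A : EuclideanSpace ℝ (Fin d) → Matrix (Fin n) (Fin n) ℂ) (ε : ℝ)
    (x : EuclideanSpace ℝ (Fin d)) : ℝ :=
  sSup (Complex.re '' pseudospectrum A ε x)

/-- `z` is a rightmost point of `Λ_ε(x)`, i.e. an optimal point of the problem of maximizing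
`Re z` subject to `σ(x, z) - ε ≤ 0`. -/
def IsRightmost {d n : ℕ} (A : EuclideanSpace ℝ (Fin d) → Matrix (Fin n) (Fin n) ℂ) (ε : ℝ)
    (x : EuclideanSpace ℝ (Fin d)) (z : ℂ) : Prop :=
  z ∈ pseudospectrum A ε x ∧ ∀ w ∈ pseudospectrum A ε x, w.re ≤ z.re

/-- The function `σ(x, z) = σ_min(A(x) - (z₁ + i z₂) I)`, as a function of `x` and
`y = (z₁, z₂, μ)` (not depending on `μ`). -/
def sigma {d n : ℕ} (A : EuclideanSpace ℝ (Fin d) → Matrix (Fin n) (Fin n) ℂ)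
    (x : EuclideanSpace ℝ (Fin d)) (y : Fin 3 → ℝ) : ℝ :=
  sigmaMin (shifted A x ⟨y 0, y 1⟩)

/-- The Lagrangian `L(x, y) = z₁ - μ (σ(x, z) - ε)`, `y = (z₁, z₂, μ)`. -/
def lagrangian {d n : ℕ} (A : EuclideanSpace ℝ (Fin d) → Matrix (Fin n) (Fin n) ℂ) (ε : ℝ)
    (x : EuclideanSpace ℝ (Fin d)) (y : Fin 3 → ℝ) : ℝ :=
  y 0 - y 2 * (sigma A x y - ε)

/-- `y = (z₁, z₂, μ)`. -/
def mkY (z : ℂ) (μ : ℝ) : Fin 3 → ℝ := ![z.re, z.im, μ]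

/-- The partial derivative `∂F/∂x_j`. -/
def partialX {d : ℕ} (j : Fin d) (F : EuclideanSpace ℝ (Fin d) → (Fin 3 → ℝ) → ℝ) :
    EuclideanSpace ℝ (Fin d) → (Fin 3 → ℝ) → ℝ :=
  fun x y => lineDeriv ℝ (fun x' => F x' y) x (EuclideanSpace.single j 1)

/-- The partial derivative `∂F/∂y_l`. -/
def partialY {d : ℕ} (l : Fin 3) (F : EuclideanSpace ℝ (Fin d) → (Fin 3 → ℝ) → ℝ) :
    EuclideanSpace ℝ (Fin d) → (Fin 3 → ℝ) → ℝ :=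
  fun x y => lineDeriv ℝ (fun y' => F x y') y (Pi.single l 1)

/-- `∇²_{xx} F`, a `d × d` matrix. -/
def hessXX {d : ℕ} (F : EuclideanSpace ℝ (Fin d) → (Fin 3 → ℝ) → ℝ)
    (x : EuclideanSpace ℝ (Fin d)) (y : Fin 3 → ℝ) : Matrix (Fin d) (Fin d) ℝ :=
  Matrix.of fun j l => partialX l (partialX j F) x y

/-- `∇²_{xy} F`, a `d × 3` matrix. -/
def hessXY {d : ℕ} (F : EuclideanSpace ℝ (Fin d) → (Fin 3 → ℝ) → ℝ)
    (x : EuclideanSpace ℝ (Fin d)) (y : Fin 3 → ℝ) : Matrix (Fin d) (Fin 3) ℝ :=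
  Matrix.of fun j l => partialY l (partialX j F) x y

/-- `∇²_{yy} F`, a `3 × 3` matrix. -/
def hessYY {d : ℕ} (F : EuclideanSpace ℝ (Fin d) → (Fin 3 → ℝ) → ℝ)
    (x : EuclideanSpace ℝ (Fin d)) (y : Fin 3 → ℝ) : Matrix (Fin 3) (Fin 3) ℝ :=
  Matrix.of fun j l => partialY l (partialY j F) x y

/-- The Hessian matrix `∇² g (x)` of a real function on `ℝ^d`. -/
def hessian {d : ℕ} (g : EuclideanSpace ℝ (Fin d) → ℝ) (x : EuclideanSpace ℝ (Fin d)) :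
    Matrix (Fin d) (Fin d) ℝ :=
  Matrix.of fun j l =>
    lineDeriv ℝ (fun x' => lineDeriv ℝ g x' (EuclideanSpace.single j 1)) x
      (EuclideanSpace.single l 1)

/-- `μ` is a Lagrange multiplier at the point `z` for the problem of maximizing `z₁` subject to
`σ(x, z) - ε ≤ 0`: `μ ≥ 0`, `L_{z₁} = L_{z₂} = 0`, and `μ (σ(x, z) - ε) = 0`. -/
def IsMultiplier {d n : ℕ} (A : EuclideanSpace ℝ (Fin d) → Matrix (Fin n) (Fin n) ℂ) (ε : ℝ)
    (x : EuclideanSpace ℝ (Fin d)) (z : ℂ) (μ : ℝ) : Prop :=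
  0 ≤ μ ∧
    partialY 0 (lagrangian A ε) x (mkY z μ) = 0 ∧
    partialY 1 (lagrangian A ε) x (mkY z μ) = 0 ∧
    μ * (sigma A x (mkY z μ) - ε) = 0

/-- Nondegenerate points. The existence and uniqueness of the multiplier `μ(x)` follow from the
first two conditions; they are not assumed here. -/
def Nondegenerate {d n : ℕ} (A : EuclideanSpace ℝ (Fin d) → Matrix (Fin n) (Fin n) ℂ) (ε : ℝ)
    (x : EuclideanSpace ℝ (Fin d)) : Prop :=
  (∃! z : ℂ, IsRightmost A ε x z) ∧
    (∀ z : ℂ, IsRightmost A ε x z → SigmaMinSimple (shifted A x z)) ∧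
    (∀ (z : ℂ) (μ : ℝ), IsRightmost A ε x z → IsMultiplier A ε x z μ →
      IsUnit (hessYY (lagrangian A ε) x (mkY z μ)))

end PsAbscissa

end

/-! The abscissa is the value of a constrained maximum, studied through its Lagrangian. A positive
simple `σ` is analytic because `σ²` is a simple root of the characteristic polynomial of `M* M`
(`analyticAt_sigmaMin`), and its first derivatives are `Re (u* M' v)` (`deriv_sigmaMin`). In
particular `σ_{z₁} = -Re (u* v)` and `σ_{z₂} = Im (u* v)`. At a rightmost point `σ = ε`, `σ_{z₂} =
0` and `σ_{z₁} ≥ 0`.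

The crux is `u* v ≠ 0` (`dotProduct_ne_zero_of_rightmost`). The holomorphic function `v* (zI - A)⁻¹
u` has modulus `1/ε` at the rightmost point and smaller modulus to its right. At a critical point
the modulus would grow in some direction pointing right, and the derivative there is a multiple of
`u* v`. Hence `σ_{z₁} > 0`, and the multiplier is `1/σ_{z₁} = -1/(u* v)`.

Since `∇²_{yy} L` is nonsingular, the implicit function theorem gives an analytic branch `Y` of
solutions of `L_y = 0` (`exists_analytic_stationary`). By compactness and uniqueness, rightmost
points of nearby problems stay near `z` (`eventually_isRightmost_mem`); with the multiplier
`1/σ_{z₁}` they solve the same equations, so they lie on the branch. Thus `α_ε = Y₀ = L(x, Y(x))`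
near the given point. The gradient is then `L_x` (envelope theorem), and differentiating once more
together with `L_y = 0` gives the Schur complement (`hessian_eq_schur_complement`). -/

namespace PsAbscissa

open Matrix Filter Topology
open scoped ContDiff

/-! ### Variational and algebraic descriptions of the smallest singular value. -/

section SmallestSingularValue

variable {n : ℕ}

theorem sigmaMin_nonneg (M : Matrix (Fin n) (Fin n) ℂ) : 0 ≤ sigmaMin M :=
  LinearMap.singularValues_nonneg _ _

theorem sigmaMin_sq [NeZero n] (M : Matrix (Fin n) (Fin n) ℂ) :
    sigmaMin M ^ 2 = (toEuclideanLin M).isSymmetric_adjoint_comp_self.eigenvalues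
      finrank_euclideanSpace_fin ⟨n - 1, Nat.sub_one_lt (NeZero.ne n)⟩ :=
  (toEuclideanLin M).sq_singularValues_of_lt finrank_euclideanSpace_fin _

/-- Parseval in an orthonormal eigenbasis of `T* T`; it yields the variational lower bound `σ ‖v‖ ≤
‖M v‖`. -/
theorem norm_toEuclideanLin_sq (M : Matrix (Fin n) (Fin n) ℂ) (v : EuclideanSpace ℂ (Fin n)) :
    ‖toEuclideanLin M v‖ ^ 2 =
      ∑ i, (toEuclideanLin M).isSymmetric_adjoint_comp_self.eigenvalues
        finrank_euclideanSpace_fin i * ‖inner ℂ ((toEuclideanLin M).isSymmetric_adjoint_comp_self.eigenvectorBasis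
        finrank_euclideanSpace_fin i) v‖ ^ 2 := by
  set T := toEuclideanLin M
  set hT := T.isSymmetric_adjoint_comp_self
  set b := hT.eigenvectorBasis finrank_euclideanSpace_fin
  have h1 : (‖T v‖ ^ 2 : ℂ) = inner ℂ v ((LinearMap.adjoint T ∘ₗ T) v) := by
    rw [LinearMap.comp_apply, LinearMap.adjoint_inner_right, inner_self_eq_norm_sq_to_K]; rfl
  have h2 : inner ℂ v ((LinearMap.adjoint T ∘ₗ T) v) =
      ∑ i, ((hT.eigenvalues finrank_euclideanSpace_fin i * ‖inner ℂ (b i) v‖ ^ 2 : ℝ) : ℂ) := by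
    rw [← b.sum_inner_mul_inner]
    refine Finset.sum_congr rfl fun i _ => ?_
    rw [← hT (b i) v, hT.apply_eigenvectorBasis, inner_smul_left]
    have := RCLike.conj_mul (inner ℂ (b i) v)
    rw [inner_conj_symm] at this
    push_cast
    change _ = _ * ((‖inner ℂ (b i) v‖ : ℂ) ^ 2)
    simp only [Complex.coe_algebraMap] at this
    rw [show ((‖inner ℂ (b i) v‖ : ℂ) ^ 2) = inner ℂ v (b i) * inner ℂ (b i) v from this.symm]
    simp
    ring
  rw [h2] at h1
  exact_mod_cast h1

theorem sigmaMin_mul_norm_le [NeZero n] (M : Matrix (Fin n) (Fin n) ℂ)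
    (v : EuclideanSpace ℂ (Fin n)) : sigmaMin M * ‖v‖ ≤ ‖toEuclideanLin M v‖ := by
  refine le_of_sq_le_sq ?_ (norm_nonneg _)
  rw [norm_toEuclideanLin_sq, mul_pow, sigmaMin_sq,
    ← ((toEuclideanLin M).isSymmetric_adjoint_comp_self.eigenvectorBasis
        finrank_euclideanSpace_fin).sum_sq_norm_inner_right v, Finset.mul_sum]
  refine Finset.sum_le_sum fun i _ => mul_le_mul_of_nonneg_right ?_ (sq_nonneg _)
  apply (toEuclideanLin M).isSymmetric_adjoint_comp_self.eigenvalues_antitone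
  exact Fin.mk_le_mk.mpr (by omega)

theorem exists_norm_one_eigenvector [NeZero n] (M : Matrix (Fin n) (Fin n) ℂ) :
    ∃ v : EuclideanSpace ℂ (Fin n), ‖v‖ = 1 ∧
      LinearMap.adjoint (toEuclideanLin M) (toEuclideanLin M v) = ((sigmaMin M ^ 2 : ℝ) : ℂ) • v := by
  refine ⟨(toEuclideanLin M).isSymmetric_adjoint_comp_self.eigenvectorBasis
        finrank_euclideanSpace_fin ⟨n - 1, Nat.sub_one_lt (NeZero.ne n)⟩,
        OrthonormalBasis.norm_eq_one _ _, ?_⟩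
  rw [sigmaMin_sq]
  exact (toEuclideanLin M).isSymmetric_adjoint_comp_self.apply_eigenvectorBasis
        finrank_euclideanSpace_fin ⟨n - 1, Nat.sub_one_lt (NeZero.ne n)⟩

theorem norm_eq_sigmaMin_of_eigenvector (M : Matrix (Fin n) (Fin n) ℂ)
    {v : EuclideanSpace ℂ (Fin n)} (hv : ‖v‖ = 1)
    (h : LinearMap.adjoint (toEuclideanLin M) (toEuclideanLin M v) =
      ((sigmaMin M ^ 2 : ℝ) : ℂ) • v) : ‖toEuclideanLin M v‖ = sigmaMin M := by
  have h1 : inner ℂ v (LinearMap.adjoint (toEuclideanLin M) (toEuclideanLin M v)) =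
    ((‖toEuclideanLin M v‖ : ℝ) : ℂ) ^ 2 := by
    rw [LinearMap.adjoint_inner_right, inner_self_eq_norm_sq_to_K]; rfl
  rw [h, inner_smul_right, inner_self_eq_norm_sq_to_K, hv] at h1
  have h2 : sigmaMin M ^ 2 = ‖toEuclideanLin M v‖ ^ 2 := by
    have : ((sigmaMin M ^ 2 : ℝ) : ℂ) = ((‖toEuclideanLin M v‖ : ℝ) : ℂ) ^ 2 := by
      rw [← h1]; simp
    exact_mod_cast this
  exact ((pow_left_inj₀ (sigmaMin_nonneg M) (norm_nonneg _) two_ne_zero).mp h2).symm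

/-- Test `M` on a unit vector at which `N` attains its minimum. By symmetry `sigmaMin` is Lipschitz,
hence continuous. -/
theorem sigmaMin_le_add [NeZero n] (M N : Matrix (Fin n) (Fin n) ℂ) :
    sigmaMin M ≤ sigmaMin N + ‖toEuclideanCLM (𝕜 := ℂ) (M - N)‖ := by
  obtain ⟨v, hv, h⟩ := exists_norm_one_eigenvector N
  have h1 := sigmaMin_mul_norm_le M v
  have h2 := norm_eq_sigmaMin_of_eigenvector N hv h
  have h3 : toEuclideanLin M v = toEuclideanLin N v + toEuclideanCLM (𝕜 := ℂ) (M - N) v := by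
    rw [show toEuclideanCLM (𝕜 := ℂ) (M - N) v = toEuclideanLin (M - N) v from rfl, map_sub]
    simp
  have h4 := (toEuclideanCLM (𝕜 := ℂ) (M - N)).le_opNorm v
  have h5 := norm_add_le (toEuclideanLin N v) (toEuclideanCLM (𝕜 := ℂ) (M - N) v)
  rw [hv, mul_one] at h1 h4
  rw [← h3] at h5
  linarith

theorem continuous_toEuclideanCLM :
    Continuous (fun M : Matrix (Fin n) (Fin n) ℂ => toEuclideanCLM (𝕜 := ℂ) M) :=
  LinearMap.continuous_of_finiteDimensional
    (toEuclideanCLM (𝕜 := ℂ) (n := Fin n)).toAlgEquiv.toLinearMap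

theorem continuous_sigmaMin [NeZero n] :
    Continuous (sigmaMin : Matrix (Fin n) (Fin n) ℂ → ℝ) := by
  rw [continuous_iff_continuousAt]
  intro N
  have hd : Tendsto (fun M : Matrix (Fin n) (Fin n) ℂ => ‖toEuclideanCLM (𝕜 := ℂ) (M - N)‖)
      (𝓝 N) (𝓝 0) := by
    have : Continuous (fun M : Matrix (Fin n) (Fin n) ℂ => ‖toEuclideanCLM (𝕜 := ℂ) (M - N)‖) :=
      (continuous_toEuclideanCLM.comp (continuous_id.sub continuous_const)).norm
    simpa using this.tendsto N
  refine tendsto_iff_dist_tendsto_zero.2 (squeeze_zero (fun _ => dist_nonneg) (fun M => ?_) hd)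
  rw [Real.dist_eq, abs_le]
  have h1 := sigmaMin_le_add M N
  have h2 := sigmaMin_le_add N M
  rw [← neg_sub M N, map_neg, norm_neg] at h2
  constructor <;> linarith

theorem charpoly_conjTranspose_mul_self (M : Matrix (Fin n) (Fin n) ℂ) :
    (Mᴴ * M).charpoly = ∏ i : Fin n, (Polynomial.X - Polynomial.C
      (((toEuclideanLin M).singularValues i ^ 2 : ℝ) : ℂ)) := by
  have h := (toEuclideanLin M).isSymmetric_adjoint_comp_self.charpoly_eq
    finrank_euclideanSpace_fin
  have h2 : LinearMap.adjoint (toEuclideanLin M) ∘ₗ toEuclideanLin M = toEuclideanLin (Mᴴ * M) := by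
    rw [← toEuclideanLin_conjTranspose_eq_adjoint]
    ext v
    simp [toLpLin_apply]
  have h3 : (toEuclideanLin (Mᴴ * M)).charpoly = (Mᴴ * M).charpoly := by
    rw [toEuclideanLin_eq_toLin_orthonormal, charpoly_toLin]
  rw [← h3, ← h2, h]
  refine Finset.prod_congr rfl fun i _ => ?_
  rw [← (toEuclideanLin M).sq_singularValues_fin]
  rfl

theorem eval_charpoly_sigmaMin_sq [NeZero n] (M : Matrix (Fin n) (Fin n) ℂ) :
    (Mᴴ * M).charpoly.eval ((sigmaMin M ^ 2 : ℝ) : ℂ) = 0 := by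
  rw [charpoly_conjTranspose_mul_self, Polynomial.eval_prod]
  refine Finset.prod_eq_zero (Finset.mem_univ ⟨n - 1, Nat.sub_one_lt (NeZero.ne n)⟩) ?_
  simp [sigmaMin]

/-- At a simple root the derivative is the product of the differences `σ² - σⱼ²` over the other
indices. Its being real lets the real implicit function theorem act on the real part of the
characteristic polynomial. -/
theorem exists_real_derivative_charpoly_ne_zero {M : Matrix (Fin n) (Fin n) ℂ}
    (hM : SigmaMinSimple M) :
    ∃ c : ℝ, c ≠ 0 ∧ (Mᴴ * M).charpoly.derivative.eval ((sigmaMin M ^ 2 : ℝ) : ℂ) = c := by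
  obtain ⟨i, hi, hu⟩ := hM
  refine ⟨∏ j ∈ Finset.univ.erase i,
    (sigmaMin M ^ 2 - (toEuclideanLin M).singularValues j ^ 2), ?_, ?_⟩
  · rw [Finset.prod_ne_zero_iff]
    intro j hj h
    refine (Finset.mem_erase.1 hj).1 (hu j ?_)
    exact ((pow_left_inj₀ (sigmaMin_nonneg M) (LinearMap.singularValues_nonneg _ _)
      two_ne_zero).mp (sub_eq_zero.1 h)).symm
  · rw [charpoly_conjTranspose_mul_self, ← Finset.mul_prod_erase _ _ (Finset.mem_univ i),
      Polynomial.derivative_mul, Polynomial.eval_add, Polynomial.eval_mul, Polynomial.eval_mul,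
      Polynomial.derivative_sub, Polynomial.derivative_X, Polynomial.derivative_C]
    have hi' : (toEuclideanLin M).singularValues i = sigmaMin M := hi
    simp [Polynomial.eval_prod, hi']

end SmallestSingularValue

/-! ### First-order perturbation of the smallest singular value. -/

section Perturbation

variable {n : ℕ}

theorem norm_toLp_eq_one {w : Fin n → ℂ} (h : star w ⬝ᵥ w = 1) : ‖WithLp.toLp 2 w‖ = 1 := by
  have h1 : ((‖WithLp.toLp 2 w‖ : ℝ) : ℂ) ^ 2 = 1 := by
    rw [← h, dotProduct_comm]
    exact (inner_self_eq_norm_sq_to_K (𝕜 := ℂ) (WithLp.toLp 2 w)).symm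
  have h2 : ‖WithLp.toLp 2 w‖ ^ 2 = 1 := by exact_mod_cast h1
  exact (pow_eq_one_iff_of_nonneg (norm_nonneg _) two_ne_zero).1 h2

theorem IsConsistentPair.norm_left {M : Matrix (Fin n) (Fin n) ℂ} {u v : Fin n → ℂ}
    (h : IsConsistentPair M u v) : ‖WithLp.toLp 2 u‖ = 1 :=
  norm_toLp_eq_one h.1

theorem IsConsistentPair.norm_right {M : Matrix (Fin n) (Fin n) ℂ} {u v : Fin n → ℂ}
    (h : IsConsistentPair M u v) : ‖WithLp.toLp 2 v‖ = 1 :=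
  norm_toLp_eq_one h.2.1

theorem exists_isConsistentPair [NeZero n] (M : Matrix (Fin n) (Fin n) ℂ) (hM : 0 < sigmaMin M) :
    ∃ u v, IsConsistentPair M u v := by
  obtain ⟨v, hv, h⟩ := exists_norm_one_eigenvector M
  have hn := norm_eq_sigmaMin_of_eigenvector M hv h
  have hσ : (sigmaMin M : ℂ) ≠ 0 := by exact_mod_cast hM.ne'
  have key : ∀ w : EuclideanSpace ℂ (Fin n), ‖w‖ = 1 → star w.ofLp ⬝ᵥ w.ofLp = 1 := by
    intro w hw
    have := inner_self_eq_norm_sq_to_K (𝕜 := ℂ) w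
    rw [EuclideanSpace.inner_eq_star_dotProduct, dotProduct_comm, hw] at this
    simpa using this
  set u : EuclideanSpace ℂ (Fin n) := ((sigmaMin M : ℂ)⁻¹) • toEuclideanLin M v with hu
  have hun : ‖u‖ = 1 := by
    rw [hu, norm_smul, hn, norm_inv, Complex.norm_real, Real.norm_of_nonneg hM.le,
      inv_mul_cancel₀ hM.ne']
  have hMu : M *ᵥ v.ofLp = (sigmaMin M : ℂ) • u.ofLp := by
    rw [hu, WithLp.ofLp_smul, smul_smul, mul_inv_cancel₀ hσ, one_smul]
    simp [toLpLin_apply]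
  have hadj : Mᴴ *ᵥ u.ofLp = (sigmaMin M : ℂ) • v.ofLp := by
    rw [← toEuclideanLin_conjTranspose_eq_adjoint] at h
    have h' := congrArg WithLp.ofLp h
    simp only [toLpLin_apply, WithLp.ofLp_smul] at h'
    rw [hMu, mulVec_smul] at h'
    have h2 : (sigmaMin M : ℂ) • (Mᴴ *ᵥ u.ofLp) =
        (sigmaMin M : ℂ) • ((sigmaMin M : ℂ) • v.ofLp) := by
      rw [h', smul_smul]; push_cast; rw [sq]
    exact smul_right_injective _ hσ h2
  refine ⟨u.ofLp, v.ofLp, key u hun, key v hv, hMu, ?_⟩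
  have := congrArg star hadj
  rwa [star_mulVec, conjTranspose_conjTranspose, star_smul, Complex.star_def,
    Complex.conj_ofReal] at this

/-- The derivative of a simple smallest singular value along a curve of matrices, by comparison
with the norm of the image of a fixed singular vector. -/
theorem deriv_sigmaMin [NeZero n] {M : ℝ → Matrix (Fin n) (Fin n) ℂ}
    {M' : Matrix (Fin n) (Fin n) ℂ} {t : ℝ}
    (hM : ∀ p q, HasDerivAt (fun s => M s p q) (M' p q) t)
    (hσ : 0 < sigmaMin (M t)) (hd : DifferentiableAt ℝ (fun s => sigmaMin (M s)) t)
    {u v : Fin n → ℂ} (huv : IsConsistentPair (M t) u v) :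
    deriv (fun s => sigmaMin (M s)) t = (star u ⬝ᵥ M' *ᵥ v).re := by
  have hw : ∀ p, HasDerivAt (fun s => (M s *ᵥ v) p) ((M' *ᵥ v) p) t := by
    intro p
    simp only [mulVec, dotProduct]
    exact HasDerivAt.fun_sum fun q _ => (hM p q).mul_const (v q)
  have hφ : HasDerivAt (fun s => ∑ p, ‖(M s *ᵥ v) p‖ ^ 2)
      (∑ p, 2 * inner ℝ ((M t *ᵥ v) p) ((M' *ᵥ v) p)) t :=
    HasDerivAt.fun_sum fun p _ => (hw p).norm_sq
  have hψ := hφ.sub (hd.hasDerivAt.pow 2)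
  have hnorm : ∀ s, ∑ p, ‖(M s *ᵥ v) p‖ ^ 2 = ‖toEuclideanLin (M s) (WithLp.toLp 2 v)‖ ^ 2 := by
    intro s
    rw [EuclideanSpace.norm_sq_eq]
    simp [toLpLin_apply]
  have hsum : ∑ p, 2 * inner ℝ ((M t *ᵥ v) p) ((M' *ᵥ v) p) =
      2 * sigmaMin (M t) * (star u ⬝ᵥ M' *ᵥ v).re := by
    rw [huv.2.2.1, dotProduct, Complex.re_sum, Finset.mul_sum]
    refine Finset.sum_congr rfl fun p _ => ?_
    rw [Complex.inner, mul_comm ((M' *ᵥ v) p)]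
    simp only [Pi.smul_apply, smul_eq_mul, map_mul, Complex.conj_ofReal, mul_assoc,
      Complex.re_ofReal_mul, Pi.star_apply, Complex.star_def]
  -- `‖M(s) v‖² ≥ σ(s)²` for the fixed unit vector `v`, with equality at `s = t`, so the derivatives
  -- of both sides agree there. No differentiability of singular vectors is involved.
  have hmin : IsLocalMin ((fun s => ∑ p, ‖(M s *ᵥ v) p‖ ^ 2) - (fun s => sigmaMin (M s)) ^ 2) t := by
    refine Eventually.of_forall fun s => ?_
    have h1 := sigmaMin_mul_norm_le (M s) (WithLp.toLp 2 v)
    rw [huv.norm_right, mul_one] at h1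
    have h2 : ∑ p, ‖(M t *ᵥ v) p‖ ^ 2 = sigmaMin (M t) ^ 2 := by
      have h3 : toEuclideanLin (M t) (WithLp.toLp 2 v) = (sigmaMin (M t) : ℂ) • WithLp.toLp 2 u := by
        rw [toLpLin_apply]
        exact congrArg (WithLp.toLp 2) huv.2.2.1
      rw [hnorm, h3, norm_smul, huv.norm_left, mul_one, Complex.norm_real,
        Real.norm_of_nonneg hσ.le]
    simp only [Pi.sub_apply, Pi.pow_apply]
    rw [h2, sub_self, hnorm]
    exact sub_nonneg.2 (pow_le_pow_left₀ (sigmaMin_nonneg _) h1 2)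
  have h0 := hmin.hasDerivAt_eq_zero hψ
  rw [hsum] at h0
  have h4 : 2 * sigmaMin (M t) * ((star u ⬝ᵥ M' *ᵥ v).re - deriv (fun s => sigmaMin (M s)) t) = 0 := by
    rw [← h0]; push_cast; ring
  have h5 : 2 * sigmaMin (M t) ≠ 0 := by positivity
  linarith [(mul_eq_zero.1 h4).resolve_left h5]

end Perturbation

/-! ### Analytic dependence of a simple singular value on parameters. -/

section Analyticity

variable {n : ℕ} {P : Type*} [NormedAddCommGroup P] [NormedSpace ℝ P]

theorem isInvertible_of_apply_one_ne_zero {L : ℝ →L[ℝ] ℝ} (h : L 1 ≠ 0) : L.IsInvertible := by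
  refine ⟨ContinuousLinearEquiv.unitsEquivAut ℝ (Units.mk0 _ h), ?_⟩
  ext
  simp

theorem analyticAt_det {M : P → Matrix (Fin n) (Fin n) ℂ} {p : P}
    (hM : ∀ i j, AnalyticAt ℝ (fun q => M q i j) p) : AnalyticAt ℝ (fun q => (M q).det) p := by
  simp only [det_apply, Units.smul_def, zsmul_eq_mul]
  refine Finset.analyticAt_fun_sum _ fun τ _ => analyticAt_const.mul ?_
  exact Finset.analyticAt_fun_prod _ fun i _ => hM _ _

/-- A simple positive smallest singular value depends analytically on parameters. -/
theorem analyticAt_sigmaMin [NeZero n] [CompleteSpace P] {M : P → Matrix (Fin n) (Fin n) ℂ} {p : P}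
    (hM : ∀ i j, AnalyticAt ℝ (fun q => M q i j) p)
    (hs : SigmaMinSimple (M p)) (hpos : 0 < sigmaMin (M p)) :
    AnalyticAt ℝ (fun q => sigmaMin (M q)) p := by
  -- The characteristic polynomial of `M(q)* M(q)` at a real argument, to be solved for the argument
  -- as a function of `q`.
  set F : P × ℝ → ℝ := fun q => ((scalar (Fin n) (q.2 : ℂ) - (M q.1)ᴴ * M q.1).det).re with hF
  have hFan : AnalyticAt ℝ F (p, sigmaMin (M p) ^ 2) := by
    refine (Complex.reCLM.analyticAt _).comp (analyticAt_det fun i j => ?_)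
    simp only [Matrix.sub_apply, Matrix.mul_apply, scalar_apply, conjTranspose_apply]
    have hM1 : ∀ i j, AnalyticAt ℝ (fun q : P × ℝ => M q.1 i j) (p, sigmaMin (M p) ^ 2) :=
      fun i j => AnalyticAt.fun_comp (g := fun q => M q i j) (f := Prod.fst) (hM i j) analyticAt_fst
    refine AnalyticAt.sub ?_ (Finset.analyticAt_fun_sum _ fun k _ => AnalyticAt.mul ?_ (hM1 k j))
    · by_cases hij : i = j
      · subst hij
        simp only [diagonal_apply_eq]
        exact AnalyticAt.fun_comp (g := Complex.ofReal) (f := Prod.snd) (Complex.ofRealCLM.analyticAt _) analyticAt_snd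
      · simp only [diagonal_apply_ne _ hij]
        exact analyticAt_const
    · exact AnalyticAt.fun_comp (g := star) (f := fun q : P × ℝ => M q.1 k i)
        (Complex.conjCLE.toContinuousLinearMap.analyticAt _) (hM1 k i)
  have hF0 : ∀ q, F (q, sigmaMin (M q) ^ 2) = 0 := by
    intro q
    have := eval_charpoly_sigmaMin_sq (M q)
    rw [eval_charpoly] at this
    simp only [hF, this, Complex.zero_re]
  have hcd : ContDiffAt ℝ ω F (p, sigmaMin (M p) ^ 2) := hFan.contDiffAt
  have hinv : (fderiv ℝ F (p, sigmaMin (M p) ^ 2) ∘L .inr ℝ P ℝ).IsInvertible := by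
    apply isInvertible_of_apply_one_ne_zero
    obtain ⟨c, hc, hcd⟩ := exists_real_derivative_charpoly_ne_zero hs
    have h1 : HasDerivAt (fun l : ℝ => F (p, l)) c (sigmaMin (M p) ^ 2) := by
      have h2 := ((M p)ᴴ * M p).charpoly.hasDerivAt ((sigmaMin (M p) ^ 2 : ℝ) : ℂ)
      rw [hcd] at h2
      have h3 := h2.real_of_complex
      simpa only [eval_charpoly, Complex.ofReal_re] using h3
    have h4 : HasDerivAt (fun l : ℝ => (p, l)) ((0 : P), (1 : ℝ)) (sigmaMin (M p) ^ 2) :=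
      (hasDerivAt_const _ _).prodMk (hasDerivAt_id _)
    have h5 := hFan.differentiableAt.hasFDerivAt.comp_hasDerivAt (sigmaMin (M p) ^ 2) h4
    have h6 := h5.unique h1
    simpa using h6.trans_ne hc
  have hcont : ContinuousAt (fun q => sigmaMin (M q)) p := by
    refine continuous_sigmaMin.continuousAt.comp ?_
    exact continuousAt_pi.2 fun i => continuousAt_pi.2 fun j => (hM i j).continuousAt
  have hev := hcd.eventually_apply_eq_iff_implicitFunction (by simp) hinv
  have hsq : AnalyticAt ℝ (fun q => sigmaMin (M q) ^ 2) p := by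
    have han := (hcd.contDiffAt_implicitFunction (by simp) hinv).analyticAt
    refine han.congr ?_
    -- Continuity of `σ²` keeps it in the neighbourhood where the implicit function is the only
    -- root.
    have ht : Tendsto (fun q => (q, sigmaMin (M q) ^ 2)) (𝓝 p) (𝓝 (p, sigmaMin (M p) ^ 2)) :=
      continuousAt_id.prodMk (hcont.pow 2)
    filter_upwards [ht.eventually hev] with q hq
    exact hq.1 ((hF0 q).trans (hF0 p).symm)
  have hsqrt : AnalyticAt ℝ Real.sqrt (sigmaMin (M p) ^ 2) :=
    (Real.contDiffAt_sqrt (n := ω) (by positivity)).analyticAt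
  have := hsqrt.fun_comp (f := fun q => sigmaMin (M q) ^ 2) hsq
  simpa only [Real.sqrt_sq (sigmaMin_nonneg _)] using this

end Analyticity

/-! ### Nonorthogonality of the singular vectors at a rightmost point. -/

section BoundaryDerivative

/-- For `k ≥ 2` the `k`-th power spreads the right half-plane over all arguments. The factor `2/3`
leaves room on both sides: `|arg w| ≤ π/3`, and `w ^ k * a` has argument `arg a / 3`. -/
theorem exists_re_pos_re_pow_mul_pos {k : ℕ} (hk : 2 ≤ k) {a : ℂ} (ha : a ≠ 0) :
    ∃ w : ℂ, 0 < w.re ∧ 0 < (w ^ k * a).re := by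
  have hk0 : (0 : ℝ) < k := by positivity
  have hk2 : (2 : ℝ) ≤ k := by exact_mod_cast hk
  have hpi := Real.pi_pos
  have harg := abs_le.1 (Complex.abs_arg_le_pi a)
  set θ : ℝ := -(2 / 3) * a.arg / k with hθ
  have hθk : θ * k = -(2 / 3) * a.arg := by rw [hθ]; field_simp
  refine ⟨Complex.exp (θ * Complex.I), ?_, ?_⟩
  · rw [Complex.exp_ofReal_mul_I_re]
    have hb : |θ| * k ≤ (2 / 3) * Real.pi := by
      rw [← abs_of_pos hk0, ← abs_mul, hθk, abs_mul, abs_neg, abs_of_pos (by norm_num : (0:ℝ) < 2 / 3)]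
      exact mul_le_mul_of_nonneg_left (Complex.abs_arg_le_pi a) (by norm_num)
    have hb2 : |θ| < Real.pi / 2 := by nlinarith [abs_nonneg θ]
    exact Real.cos_pos_of_mem_Ioo (abs_lt.1 hb2)
  · have h1 : Complex.exp (θ * Complex.I) ^ k * a =
        (‖a‖ : ℂ) * Complex.exp ((a.arg / 3 : ℝ) * Complex.I) := by
      rw [← Complex.exp_nat_mul]
      conv_lhs => rw [← Complex.norm_mul_exp_arg_mul_I a]
      rw [mul_left_comm, ← Complex.exp_add]
      congr 2
      have : (k : ℂ) * (θ : ℂ) = ((-(2 / 3) * a.arg : ℝ) : ℂ) := by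
        rw [← hθk]; push_cast; ring
      rw [← mul_assoc, this]
      push_cast
      ring
    rw [h1, Complex.re_ofReal_mul, Complex.exp_ofReal_mul_I_re]
    refine mul_pos (norm_pos_iff.2 ha) (Real.cos_pos_of_mem_Ioo ⟨?_, ?_⟩) <;> linarith

/-- If the modulus of a holomorphic function is smaller to the right of `z₀` than at `z₀`, then
`z₀` is not a critical point. -/
theorem deriv_ne_zero_of_norm_lt {g : ℂ → ℂ} {z₀ : ℂ} (hg : AnalyticAt ℂ g z₀)
    (hlt : ∀ᶠ z in 𝓝 z₀, z₀.re < z.re → ‖g z‖ < ‖g z₀‖) : deriv g z₀ ≠ 0 := by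
  intro hd
  have hline : ∀ w : ℂ, Tendsto (fun t : ℝ => z₀ + t * w) (𝓝[>] 0) (𝓝 z₀) := by
    intro w
    have : Continuous (fun t : ℝ => z₀ + t * w) := by fun_prop
    have h := this.tendsto 0
    simp only [Complex.ofReal_zero, zero_mul, add_zero] at h
    exact h.mono_left nhdsWithin_le_nhds
  have hre : ∀ w : ℂ, 0 < w.re → ∀ t : ℝ, 0 < t → z₀.re < (z₀ + t * w).re := by
    intro w hw t ht
    rw [Complex.add_re, Complex.re_ofReal_mul]
    linarith [mul_pos ht hw]
  have hh : AnalyticAt ℂ (fun z => g z - g z₀) z₀ := hg.sub analyticAt_const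
  have hne : ¬ ∀ᶠ z in 𝓝 z₀, g z - g z₀ = 0 := by
    intro hz
    have h1 := (hline 1).eventually (hlt.and hz)
    obtain ⟨t, ⟨h2, h3⟩, ht⟩ := (h1.and self_mem_nhdsWithin).exists
    have := h2 (hre 1 (by simp) t ht)
    rw [sub_eq_zero.1 h3] at this
    exact lt_irrefl _ this
  -- Factor `g - g z₀ = (z - z₀)^k q` with `q z₀ ≠ 0`; a vanishing derivative forces `k ≥ 2`.
  obtain ⟨k, q, hq, hq0, hev⟩ := hh.exists_eventuallyEq_pow_smul_nonzero_iff.2 hne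
  have hk0 : k ≠ 0 := by
    rintro rfl
    have := hev.self_of_nhds
    simp at this
    exact hq0 this.symm
  have hk1 : k ≠ 1 := by
    rintro rfl
    have h1 : HasDerivAt (fun z => (z - z₀) ^ 1 • q z) (q z₀) z₀ := by
      have h2 := ((hasDerivAt_id z₀).sub_const z₀).mul hq.differentiableAt.hasDerivAt
      simpa [Pi.mul_def] using h2
    have h2 : HasDerivAt (fun z => g z - g z₀) (q z₀) z₀ := h1.congr_of_eventuallyEq hev
    have h3 := (hg.differentiableAt.hasDerivAt.sub_const (g z₀)).unique h2
    exact hq0 (h3 ▸ hd)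
  have hc : g z₀ ≠ 0 := by
    intro h
    obtain ⟨t, h2, ht⟩ := (((hline 1).eventually hlt).and self_mem_nhdsWithin).exists
    have := h2 (hre 1 (by simp) t ht)
    rw [h, norm_zero] at this
    exact absurd this (norm_nonneg _).not_gt
  -- With this factor `Re (c * g z) ≤ ‖g z₀‖ ‖g z‖`, whereas along a suitable `w` pointing right the
  -- left side exceeds `‖g z₀‖²`.
  set c := starRingEnd ℂ (g z₀) with hcdef
  have hc' : c ≠ 0 := by simpa [hcdef] using hc
  obtain ⟨w, hw, hwk⟩ := exists_re_pos_re_pow_mul_pos (by omega : 2 ≤ k) (mul_ne_zero hc' hq0)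
  have hcont : Tendsto (fun t : ℝ => (w ^ k * (c * q (z₀ + t * w))).re) (𝓝[>] 0)
      (𝓝 (w ^ k * (c * q z₀)).re) := by
    have h1 := hq.continuousAt.tendsto.comp (hline w)
    exact (Complex.continuous_re.tendsto _).comp ((h1.const_mul c).const_mul (w ^ k))
  have hpos := hcont.eventually (lt_mem_nhds hwk)
  obtain ⟨t, ⟨⟨hp, hl⟩, he⟩, ht⟩ := (((hpos.and ((hline w).eventually hlt)).and
    ((hline w).eventually hev)).and self_mem_nhdsWithin).exists
  have hl' := hl (hre w hw t ht)
  set z := z₀ + t * w with hz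
  have ht0 : (0 : ℝ) < t := ht
  have h1 : c * g z = c * g z₀ + ((t ^ k : ℝ) : ℂ) * (w ^ k * (c * q z)) := by
    have h2 : g z = g z₀ + (t * w) ^ k * q z := by
      rw [← sub_eq_iff_eq_add', he, hz, add_sub_cancel_left, smul_eq_mul]
    rw [h2]; push_cast; ring
  have h2 : (c * g z₀).re = ‖g z₀‖ ^ 2 := by
    rw [hcdef, ← Complex.normSq_eq_conj_mul_self, Complex.ofReal_re, Complex.normSq_eq_norm_sq]
  have h3 : (c * g z).re ≤ ‖g z₀‖ * ‖g z‖ := by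
    refine (Complex.re_le_norm _).trans ?_
    rw [norm_mul, hcdef, Complex.norm_conj]
  rw [h1, Complex.add_re, h2, Complex.re_ofReal_mul] at h3
  have h4 : 0 < t ^ k * (w ^ k * (c * q z)).re := mul_pos (pow_pos ht0 k) hp
  nlinarith [norm_nonneg (g z), norm_pos_iff.2 hc]

variable {n : ℕ}

/-- The sign reconciles `B - z` with the resolvent convention `z - B`. -/
theorem toEuclideanLin_sub_smul (B : Matrix (Fin n) (Fin n) ℂ) (z : ℂ)
    (y : EuclideanSpace ℂ (Fin n)) :
    toEuclideanLin (B - z • (1 : Matrix (Fin n) (Fin n) ℂ)) y =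
      -((algebraMap ℂ (EuclideanSpace ℂ (Fin n) →L[ℂ] EuclideanSpace ℂ (Fin n)) z -
        toEuclideanCLM (𝕜 := ℂ) B) y) := by
  rw [map_sub, map_smul]
  have h2 : toEuclideanCLM (𝕜 := ℂ) B y = toEuclideanLin B y := rfl
  simp [h2, Algebra.algebraMap_eq_smul_one]

theorem mem_resolventSet_of_sigmaMin_pos [NeZero n] {B : Matrix (Fin n) (Fin n) ℂ} {z : ℂ}
    (h : 0 < sigmaMin (B - z • (1 : Matrix (Fin n) (Fin n) ℂ))) :
    z ∈ resolventSet ℂ (toEuclideanCLM (𝕜 := ℂ) B) := by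
  have hu : IsUnit (B - z • (1 : Matrix (Fin n) (Fin n) ℂ)) := by
    rw [← mulVec_injective_iff_isUnit]
    refine (injective_iff_map_eq_zero
      (mulVecLin (B - z • (1 : Matrix (Fin n) (Fin n) ℂ)))).2 fun y hy => ?_
    have h1 := sigmaMin_mul_norm_le (B - z • (1 : Matrix (Fin n) (Fin n) ℂ)) (WithLp.toLp 2 y)
    rw [toLpLin_apply] at h1
    rw [mulVecLin_apply] at hy
    rw [hy, WithLp.toLp_zero, norm_zero] at h1
    have h2 : ‖WithLp.toLp 2 y‖ = 0 :=
      le_antisymm (nonpos_of_mul_nonpos_right h1 h) (norm_nonneg _)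
    simpa using h2
  have h2 := (hu.map (toEuclideanCLM (𝕜 := ℂ) (n := Fin n))).neg
  rw [spectrum.mem_resolventSet_iff]
  convert h2 using 1
  rw [map_sub, map_smul, map_one, neg_sub, Algebra.algebraMap_eq_smul_one]

/-- At a boundary point of a pseudospectrum having the pseudospectrum on its left, the left and
right singular vectors are not orthogonal. -/
theorem dotProduct_ne_zero_of_rightmost [NeZero n] {B : Matrix (Fin n) (Fin n) ℂ} {z₀ : ℂ} {ε : ℝ}
    (hε : 0 < ε) (h0 : sigmaMin (B - z₀ • (1 : Matrix (Fin n) (Fin n) ℂ)) = ε)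
    (hr : ∀ z : ℂ, z₀.re < z.re → ε < sigmaMin (B - z • (1 : Matrix (Fin n) (Fin n) ℂ)))
    {u v : Fin n → ℂ} (huv : IsConsistentPair (B - z₀ • (1 : Matrix (Fin n) (Fin n) ℂ)) u v) :
    star u ⬝ᵥ v ≠ 0 := by
  intro horth
  set a := toEuclideanCLM (𝕜 := ℂ) B with ha
  set U : EuclideanSpace ℂ (Fin n) := WithLp.toLp 2 u with hU
  set V : EuclideanSpace ℂ (Fin n) := WithLp.toLp 2 v with hV
  have hεC : (ε : ℂ) ≠ 0 := by exact_mod_cast hε.ne'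
  have hUn : ‖U‖ = 1 := huv.norm_left
  have hVn : ‖V‖ = 1 := huv.norm_right
  have hz₀ : z₀ ∈ resolventSet ℂ a := mem_resolventSet_of_sigmaMin_pos (h0 ▸ hε)
  set R := resolvent (R := ℂ) a with hR
  have hRr : ∀ z ∈ resolventSet ℂ a, ∀ y, (algebraMap ℂ _ z - a) (R z y) = y := by
    intro z hz y
    have := Ring.mul_inverse_cancel (algebraMap ℂ _ z - a) hz
    exact congrArg (fun L => L y) this
  have hRl : ∀ z ∈ resolventSet ℂ a, ∀ y, R z ((algebraMap ℂ _ z - a) y) = y := by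
    intro z hz y
    have := Ring.inverse_mul_cancel (algebraMap ℂ _ z - a) hz
    exact congrArg (fun L => L y) this
  have hRU : R z₀ U = -((ε : ℂ)⁻¹ • V) := by
    have h1 : (algebraMap ℂ _ z₀ - a) V = -((ε : ℂ) • U) := by
      rw [← neg_eq_iff_eq_neg, ← toEuclideanLin_sub_smul, toLpLin_apply, ← h0]
      exact congrArg (WithLp.toLp 2) huv.2.2.1
    have h2 := hRl z₀ hz₀ V
    rw [h1, map_neg, map_smul] at h2
    rw [← h2, smul_neg, neg_neg, smul_smul, inv_mul_cancel₀ hεC, one_smul]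
  have hV' : ∀ y, inner ℂ V ((R z₀) y) = -((ε : ℂ)⁻¹ * inner ℂ U y) := by
    intro y
    have h1 : ∀ x : EuclideanSpace ℂ (Fin n), (ε : ℂ) * inner ℂ V x =
        -inner ℂ U ((algebraMap ℂ _ z₀ - a) x) := by
      intro x
      rw [← inner_neg_right, ← toEuclideanLin_sub_smul, EuclideanSpace.inner_eq_star_dotProduct,
        EuclideanSpace.inner_eq_star_dotProduct, toLpLin_apply, dotProduct_comm,
        dotProduct_comm (WithLp.ofLp _) (star U.ofLp), dotProduct_mulVec, huv.2.2.2, h0,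
        smul_dotProduct, smul_eq_mul]
    rw [← mul_right_inj' hεC, h1, hRr z₀ hz₀, mul_neg, ← mul_assoc, mul_inv_cancel₀ hεC, one_mul]
  have hderiv : ∀ z ∈ resolventSet ℂ a,
      HasDerivAt (fun z => inner ℂ V (R z U)) (inner ℂ V ((-R z ^ 2) U)) z := by
    intro z hz
    have h1 := spectrum.hasDerivAt_resolvent_const_left hz
    have h2 := (innerSL ℂ V).hasFDerivAt.comp_hasDerivAt z
      ((ContinuousLinearMap.apply ℂ _ U).hasFDerivAt.comp_hasDerivAt z h1)
    exact h2
  have hopen : resolventSet ℂ a ∈ 𝓝 z₀ := (spectrum.isOpen_resolventSet a).mem_nhds hz₀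
  have han : AnalyticAt ℂ (fun z => inner ℂ V (R z U)) z₀ := by
    refine DifferentiableOn.analyticAt (s := resolventSet ℂ a) (fun z hz => ?_) hopen
    exact (hderiv z hz).differentiableAt.differentiableWithinAt
  -- To the right, `|V* R(z) U| ≤ ‖R(z) U‖ ≤ 1/σ_min(B - z) < 1/ε`, with value `1/ε` at `z₀`. The
  -- derivative `-V* R(z₀)² U` equals `-ε⁻² U* V`, which vanishes under orthogonality.
  refine deriv_ne_zero_of_norm_lt han ?_ ?_
  · filter_upwards [hopen] with z hz hzr
    have h1 : ‖inner ℂ V (R z₀ U)‖ = ε⁻¹ := by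
      rw [hRU, inner_neg_right, inner_smul_right, inner_self_eq_norm_sq_to_K, hVn]
      simp [abs_of_pos hε]
    have h2 : ‖inner ℂ V (R z U)‖ ≤ ‖R z U‖ := by
      simpa [hVn] using norm_inner_le_norm (𝕜 := ℂ) V (R z U)
    have h3 := sigmaMin_mul_norm_le (B - z • (1 : Matrix (Fin n) (Fin n) ℂ)) (R z U)
    rw [toEuclideanLin_sub_smul, norm_neg, hRr z hz, hUn] at h3
    have h4 := hr z hzr
    change ‖inner ℂ V (R z U)‖ < ‖inner ℂ V (R z₀ U)‖
    rw [h1]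
    refine h2.trans_lt ?_
    rw [← one_div, lt_div_iff₀ hε]
    rcases (norm_nonneg (R z U)).eq_or_lt with h5 | h5
    · rw [← h5]; simp
    · nlinarith
  · rw [(hderiv z₀ hz₀).deriv]
    have h1 : ((-R z₀ ^ 2) U) = -(R z₀ (R z₀ U)) := by
      rw [sq]; rfl
    rw [h1, hRU, inner_neg_right, hV', inner_neg_right, inner_smul_right]
    have h2 : inner ℂ U V = (0 : ℂ) := by
      rw [EuclideanSpace.inner_eq_star_dotProduct, dotProduct_comm]; exact horth
    rw [h2]; simp

end BoundaryDerivative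

/-! ### Coordinate derivatives in terms of the Fréchet derivative. -/

section PartialDerivatives

variable {d : ℕ} {F : EuclideanSpace ℝ (Fin d) → (Fin 3 → ℝ) → ℝ}
  {p : EuclideanSpace ℝ (Fin d) × (Fin 3 → ℝ)}

theorem partialX_eq_fderiv (j : Fin d) (hF : DifferentiableAt ℝ (Function.uncurry F) p) :
    partialX j F p.1 p.2 = fderiv ℝ (Function.uncurry F) p (EuclideanSpace.single j 1, 0) := by
  have h1 : HasDerivAt (fun t : ℝ => (p.1 + t • EuclideanSpace.single j (1 : ℝ), p.2))
      (EuclideanSpace.single j (1 : ℝ), (0 : Fin 3 → ℝ)) 0 := by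
    refine HasDerivAt.prodMk ?_ (hasDerivAt_const _ _)
    simpa using ((hasDerivAt_id (0 : ℝ)).smul_const (EuclideanSpace.single j (1 : ℝ))).const_add p.1
  have h2 : HasFDerivAt (Function.uncurry F) (fderiv ℝ (Function.uncurry F) p)
      (p.1 + (0 : ℝ) • EuclideanSpace.single j (1 : ℝ), p.2) := by
    simpa using hF.hasFDerivAt
  exact (h2.comp_hasDerivAt (0 : ℝ) h1).deriv

theorem partialY_eq_fderiv (l : Fin 3) (hF : DifferentiableAt ℝ (Function.uncurry F) p) :
    partialY l F p.1 p.2 = fderiv ℝ (Function.uncurry F) p (0, Pi.single l 1) := by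
  have h1 : HasDerivAt (fun t : ℝ => (p.1, p.2 + t • (Pi.single l 1 : Fin 3 → ℝ)))
      ((0 : EuclideanSpace ℝ (Fin d)), (Pi.single l 1 : Fin 3 → ℝ)) 0 := by
    refine HasDerivAt.prodMk (hasDerivAt_const _ _) ?_
    simpa using ((hasDerivAt_id (0 : ℝ)).smul_const (Pi.single l 1 : Fin 3 → ℝ)).const_add p.2
  have h2 : HasFDerivAt (Function.uncurry F) (fderiv ℝ (Function.uncurry F) p)
      (p.1, p.2 + (0 : ℝ) • (Pi.single l 1 : Fin 3 → ℝ)) := by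
    simpa using hF.hasFDerivAt
  exact (h2.comp_hasDerivAt (0 : ℝ) h1).deriv

theorem fderiv_uncurry_apply_snd (hF : DifferentiableAt ℝ (Function.uncurry F) p)
    (h : Fin 3 → ℝ) :
    fderiv ℝ (Function.uncurry F) p (0, h) = ∑ l, partialY l F p.1 p.2 * h l := by
  set L := fderiv ℝ (Function.uncurry F) p ∘L .inr ℝ _ (Fin 3 → ℝ) with hL
  have h1 : h = ∑ l, h l • (Pi.single l 1 : Fin 3 → ℝ) := by
    conv_lhs => rw [← Finset.univ_sum_single h]
    simp [← Pi.single_smul]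
  change L h = _
  rw [h1, map_sum]
  refine Finset.sum_congr rfl fun l _ => ?_
  rw [← h1, map_smul, partialY_eq_fderiv l hF, smul_eq_mul, mul_comm]
  rfl

/-- The identity holds near `p`, not merely at `p`, so it can be differentiated again. -/
theorem eventually_partialX_eq_fderiv (j : Fin d) (hF : AnalyticAt ℝ (Function.uncurry F) p) :
    Function.uncurry (partialX j F) =ᶠ[𝓝 p]
      fun q => fderiv ℝ (Function.uncurry F) q (EuclideanSpace.single j 1, 0) := by
  filter_upwards [hF.eventually_analyticAt] with q hq
  exact partialX_eq_fderiv j hq.differentiableAt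

theorem eventually_partialY_eq_fderiv (l : Fin 3) (hF : AnalyticAt ℝ (Function.uncurry F) p) :
    Function.uncurry (partialY l F) =ᶠ[𝓝 p]
      fun q => fderiv ℝ (Function.uncurry F) q (0, Pi.single l 1) := by
  filter_upwards [hF.eventually_analyticAt] with q hq
  exact partialY_eq_fderiv l hq.differentiableAt

theorem analyticAt_fderiv_apply {E : Type*} [NormedAddCommGroup E] [NormedSpace ℝ E] {f : E → ℝ}
    {a : E} (hf : AnalyticAt ℝ f a) (v : E) : AnalyticAt ℝ (fun b => fderiv ℝ f b v) a :=
  ((ContinuousLinearMap.apply ℝ ℝ v).analyticAt _).comp hf.fderiv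

theorem analyticAt_partialX (j : Fin d) (hF : AnalyticAt ℝ (Function.uncurry F) p) :
    AnalyticAt ℝ (Function.uncurry (partialX j F)) p :=
  (analyticAt_fderiv_apply hF _).congr (eventually_partialX_eq_fderiv j hF).symm

theorem analyticAt_partialY (l : Fin 3) (hF : AnalyticAt ℝ (Function.uncurry F) p) :
    AnalyticAt ℝ (Function.uncurry (partialY l F)) p :=
  (analyticAt_fderiv_apply hF _).congr (eventually_partialY_eq_fderiv l hF).symm

theorem partialX_partialY_comm (j : Fin d) (l : Fin 3)
    (hF : AnalyticAt ℝ (Function.uncurry F) p) :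
    partialX j (partialY l F) p.1 p.2 = partialY l (partialX j F) p.1 p.2 := by
  have hd := hF.fderiv.differentiableAt
  rw [partialX_eq_fderiv j (analyticAt_partialY l hF).differentiableAt,
    partialY_eq_fderiv l (analyticAt_partialX j hF).differentiableAt,
    (eventually_partialX_eq_fderiv j hF).fderiv_eq, (eventually_partialY_eq_fderiv l hF).fderiv_eq,
    fderiv_clm_apply hd (differentiableAt_const _), fderiv_clm_apply hd (differentiableAt_const _)]
  have hs : IsSymmSndFDerivAt ℝ (Function.uncurry F) p :=
    (hF.contDiffAt (n := 2)).isSymmSndFDerivAt (by simp)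
  simpa using hs.eq _ _

end PartialDerivatives

/-! ### Envelope theorem, second-order formula and implicit function theorem. -/

section Envelope

variable {d : ℕ} {F : EuclideanSpace ℝ (Fin d) → (Fin 3 → ℝ) → ℝ}
  {x : EuclideanSpace ℝ (Fin d)}

/-- The chain rule for `x ↦ F x (Y x)` in a coordinate direction. -/
theorem lineDeriv_comp_graph {Y : EuclideanSpace ℝ (Fin d) → Fin 3 → ℝ}
    (hF : DifferentiableAt ℝ (Function.uncurry F) (x, Y x)) (hY : DifferentiableAt ℝ Y x)
    (j : Fin d) :
    lineDeriv ℝ (fun x' => F x' (Y x')) x (EuclideanSpace.single j 1) =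
      partialX j F x (Y x) + ∑ l, partialY l F x (Y x) *
        fderiv ℝ Y x (EuclideanSpace.single j 1) l := by
  have h1 : HasFDerivAt (fun x' => (x', Y x')) ((ContinuousLinearMap.id ℝ _).prod (fderiv ℝ Y x)) x :=
    (hasFDerivAt_id x).prodMk hY.hasFDerivAt
  have h2 : HasFDerivAt (fun x' => F x' (Y x'))
      (fderiv ℝ (Function.uncurry F) (x, Y x) ∘L (ContinuousLinearMap.id ℝ _).prod (fderiv ℝ Y x)) x :=
    HasFDerivAt.comp (g := Function.uncurry F) x hF.hasFDerivAt h1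
  rw [h2.differentiableAt.lineDeriv_eq_fderiv, h2.fderiv, ContinuousLinearMap.comp_apply,
    ContinuousLinearMap.prod_apply, ContinuousLinearMap.id_apply,
    ← fderiv_uncurry_apply_snd hF, partialX_eq_fderiv j hF, ← map_add]
  simp

/-- Envelope theorem: stationarity in `y` kills the contribution of `Y'`. It holds on a
neighbourhood, ready for a second differentiation. -/
theorem eventually_lineDeriv_eq_partialX {α : EuclideanSpace ℝ (Fin d) → ℝ}
    {Y : EuclideanSpace ℝ (Fin d) → Fin 3 → ℝ}
    (hF : AnalyticAt ℝ (Function.uncurry F) (x, Y x)) (hY : AnalyticAt ℝ Y x)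
    (hα : α =ᶠ[𝓝 x] fun x' => F x' (Y x'))
    (hst : ∀ᶠ x' in 𝓝 x, ∀ l, partialY l F x' (Y x') = 0) (j : Fin d) :
    ∀ᶠ x' in 𝓝 x, lineDeriv ℝ α x' (EuclideanSpace.single j 1) = partialX j F x' (Y x') := by
  have hg : Tendsto (fun x' => (x', Y x')) (𝓝 x) (𝓝 (x, Y x)) :=
    continuousAt_id.prodMk hY.continuousAt
  filter_upwards [hα.eventuallyEq_nhds, hst, hY.eventually_analyticAt,
    hg.eventually hF.eventually_analyticAt] with x' h1 h2 h3 h4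
  rw [h1.lineDeriv_eq, lineDeriv_comp_graph h4.differentiableAt h3.differentiableAt]
  simp [h2]

/-- The Hessian of the value function along a curve of stationary points. -/
theorem hessian_eq_schur_complement {α : EuclideanSpace ℝ (Fin d) → ℝ}
    {Y : EuclideanSpace ℝ (Fin d) → Fin 3 → ℝ}
    (hF : AnalyticAt ℝ (Function.uncurry F) (x, Y x)) (hY : AnalyticAt ℝ Y x)
    (hα : α =ᶠ[𝓝 x] fun x' => F x' (Y x'))
    (hst : ∀ᶠ x' in 𝓝 x, ∀ l, partialY l F x' (Y x') = 0)
    (hu : IsUnit (hessYY F x (Y x))) :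
    hessian α x = hessXX F x (Y x) -
      hessXY F x (Y x) * (hessYY F x (Y x))⁻¹ * (hessXY F x (Y x))ᵀ := by
  set W : Matrix (Fin 3) (Fin d) ℝ :=
    of fun m l => fderiv ℝ Y x (EuclideanSpace.single l 1) m with hW
  have h1 : hessian α x = hessXX F x (Y x) + hessXY F x (Y x) * W := by
    ext j l
    have h2 : (fun x' => lineDeriv ℝ α x' (EuclideanSpace.single j 1)) =ᶠ[𝓝 x]
        fun x' => partialX j F x' (Y x') := eventually_lineDeriv_eq_partialX hF hY hα hst j
    change lineDeriv ℝ (fun x' => lineDeriv ℝ α x' (EuclideanSpace.single j 1)) x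
      (EuclideanSpace.single l 1) = _
    rw [h2.lineDeriv_eq, lineDeriv_comp_graph (analyticAt_partialX j hF).differentiableAt
      hY.differentiableAt]
    rfl
  -- Differentiating the stationarity equations along `Y`; symmetry of mixed derivatives produces
  -- the transpose. This linear system determines `W = Y'`.
  have h3 : (hessXY F x (Y x))ᵀ + hessYY F x (Y x) * W = 0 := by
    ext m l
    have h4 : (fun x' => partialY m F x' (Y x')) =ᶠ[𝓝 x] fun _ => 0 := hst.mono fun _ h => h m
    have h5 := h4.lineDeriv_eq (𝕜 := ℝ) (v := EuclideanSpace.single l 1)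
    rw [lineDeriv_comp_graph (analyticAt_partialY m hF).differentiableAt hY.differentiableAt,
      partialX_partialY_comm (p := (x, Y x)) l m hF] at h5
    exact h5.trans (by simp [lineDeriv])
  have hdet := (isUnit_iff_isUnit_det _).1 hu
  have h6 : W = -((hessYY F x (Y x))⁻¹ * (hessXY F x (Y x))ᵀ) := by
    have h7 : hessYY F x (Y x) * W = -(hessXY F x (Y x))ᵀ := (neg_eq_of_add_eq_zero_right h3).symm
    rw [← Matrix.mul_neg, ← h7, nonsing_inv_mul_cancel_left _ _ hdet]
  rw [h1, h6, Matrix.mul_neg, ← Matrix.mul_assoc, sub_eq_add_neg]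

/-- The analytic implicit function theorem for the stationarity equations. -/
theorem exists_analytic_stationary {y : Fin 3 → ℝ}
    (hF : AnalyticAt ℝ (Function.uncurry F) (x, y)) (h0 : ∀ l, partialY l F x y = 0)
    (hu : IsUnit (hessYY F x y)) :
    ∃ Y : EuclideanSpace ℝ (Fin d) → Fin 3 → ℝ, AnalyticAt ℝ Y x ∧ Y x = y ∧
      (∀ᶠ x' in 𝓝 x, ∀ l, partialY l F x' (Y x') = 0) ∧
      ∀ᶠ p in 𝓝 (x, y), (∀ l, partialY l F p.1 p.2 = 0) → Y p.1 = p.2 := by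
  set G : EuclideanSpace ℝ (Fin d) × (Fin 3 → ℝ) → Fin 3 → ℝ :=
    fun p l => Function.uncurry (partialY l F) p with hG
  have hGan : AnalyticAt ℝ G (x, y) := analyticAt_pi_iff.2 fun l => analyticAt_partialY l hF
  have hcd : ContDiffAt ℝ ω G (x, y) := hGan.contDiffAt
  have hG0 : G (x, y) = 0 := funext h0
  have happ : ∀ h, (fderiv ℝ G (x, y) ∘L .inr ℝ _ _) h = hessYY F x y *ᵥ h := by
    intro h
    have h1 : fderiv ℝ G (x, y) = ContinuousLinearMap.pi fun l =>
        fderiv ℝ (Function.uncurry (partialY l F)) (x, y) :=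
      fderiv_pi fun l => (analyticAt_partialY l hF).differentiableAt
    ext l
    rw [h1]
    exact fderiv_uncurry_apply_snd (analyticAt_partialY l hF).differentiableAt h
  have hinv : (fderiv ℝ G (x, y) ∘L .inr ℝ _ _).IsInvertible := by
    have hinj : Function.Injective ((fderiv ℝ G (x, y) ∘L .inr ℝ _ _) :
        (Fin 3 → ℝ) →L[ℝ] (Fin 3 → ℝ)).toLinearMap := by
      intro a b hab
      refine mulVec_injective_iff_isUnit.2 hu ?_
      rw [← happ, ← happ]
      exact hab
    exact ⟨(LinearEquiv.ofInjectiveEndo _ hinj).toContinuousLinearEquiv, rfl⟩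
  refine ⟨hcd.implicitFunction (by simp) hinv,
    (hcd.contDiffAt_implicitFunction (by simp) hinv).analyticAt,
    hcd.implicitFunction_apply_self (by simp) hinv, ?_, ?_⟩
  · filter_upwards [hcd.eventually_apply_implicitFunction (by simp) hinv] with x' hx' l
    rw [hG0] at hx'
    exact congrFun hx' l
  · filter_upwards [hcd.eventually_apply_eq_iff_implicitFunction (by simp) hinv] with q hq h
    exact hq.1 (by rw [hG0]; exact funext h)

end Envelope

/-! ### Derivatives of the Lagrangian in terms of those of `σ`. -/

section Lagrangian

variable {d n : ℕ} {A : EuclideanSpace ℝ (Fin d) → Matrix (Fin n) (Fin n) ℂ} {ε : ℝ}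
  {F : EuclideanSpace ℝ (Fin d) → (Fin 3 → ℝ) → ℝ}
  {x : EuclideanSpace ℝ (Fin d)} {y : Fin 3 → ℝ}

theorem hasDerivAt_line_snd (hF : DifferentiableAt ℝ (Function.uncurry F) (x, y))
    (h : Fin 3 → ℝ) :
    HasDerivAt (fun t : ℝ => F x (y + t • h)) (∑ l, partialY l F x y * h l) 0 := by
  have h1 : HasDerivAt (fun t : ℝ => (x, y + t • h)) ((0 : EuclideanSpace ℝ (Fin d)), h) 0 := by
    refine HasDerivAt.prodMk (hasDerivAt_const _ _) ?_
    simpa using ((hasDerivAt_id (0 : ℝ)).smul_const h).const_add y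
  have h2 : HasFDerivAt (Function.uncurry F) (fderiv ℝ (Function.uncurry F) (x, y))
      (x, y + (0 : ℝ) • h) := by
    simpa using hF.hasFDerivAt
  have h3 := h2.comp_hasDerivAt (0 : ℝ) h1
  rwa [fderiv_uncurry_apply_snd hF] at h3

theorem hasDerivAt_partialY (hF : DifferentiableAt ℝ (Function.uncurry F) (x, y)) (l : Fin 3) :
    HasDerivAt (fun t : ℝ => F x (y + t • (Pi.single l 1 : Fin 3 → ℝ))) (partialY l F x y) 0 := by
  simpa [Pi.single_apply] using hasDerivAt_line_snd hF (Pi.single l 1)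

theorem sigma_congr {y' : Fin 3 → ℝ} (h0 : y 0 = y' 0) (h1 : y 1 = y' 1) :
    sigma A x y = sigma A x y' := by
  simp only [sigma, h0, h1]

theorem partialX_sigma_congr {y' : Fin 3 → ℝ} (h0 : y 0 = y' 0) (h1 : y 1 = y' 1) (j : Fin d) :
    partialX j (sigma A) x y = partialX j (sigma A) x y' := by
  simp only [partialX, sigma, h0, h1]

/-- Since `σ` ignores `μ`, its derivatives agree at different multipliers; so `μ = 1/σ_{z₁}` is not
a circular choice. -/
theorem partialY_sigma_congr {y' : Fin 3 → ℝ} (h0 : y 0 = y' 0) (h1 : y 1 = y' 1) (l : Fin 3) :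
    partialY l (sigma A) x y = partialY l (sigma A) x y' := by
  simp only [partialY, lineDeriv, sigma, Pi.add_apply, h0, h1]

theorem partialY_two_sigma : partialY 2 (sigma A) x y = 0 := by
  have : (fun t : ℝ => sigma A x (y + t • (Pi.single 2 1 : Fin 3 → ℝ))) = fun _ => sigma A x y :=
    funext fun t => sigma_congr (by simp) (by simp)
  simp only [partialY, lineDeriv, this, deriv_const]

/-- No differentiability is needed: `deriv` commutes unconditionally with constant factors and
constant shifts. -/
theorem partialX_lagrangian (j : Fin d) :
    partialX j (lagrangian A ε) = fun x y => -y 2 * partialX j (sigma A) x y := by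
  funext x y
  simp only [partialX, lineDeriv, lagrangian, deriv_const_sub, deriv_const_mul_field',
    deriv_sub_const, neg_mul]

theorem hessXX_lagrangian (j l : Fin d) :
    hessXX (lagrangian A ε) x y j l = -y 2 * hessXX (sigma A) x y j l := by
  simp only [hessXX, of_apply, partialX_lagrangian]
  simp only [partialX, lineDeriv, deriv_const_mul_field']

theorem hessXY_lagrangian_of_ne (j : Fin d) {l : Fin 3} (hl : l ≠ 2) :
    hessXY (lagrangian A ε) x y j l = -y 2 * hessXY (sigma A) x y j l := by
  simp only [hessXY, of_apply, partialX_lagrangian]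
  generalize partialX j (sigma A) = g
  simp only [partialY, lineDeriv, Pi.add_apply, Pi.smul_apply, Pi.single_eq_of_ne' hl, smul_zero,
    add_zero, deriv_const_mul_field']

theorem hessXY_lagrangian_two (j : Fin d) :
    hessXY (lagrangian A ε) x y j 2 = -partialX j (sigma A) x y := by
  simp only [hessXY, of_apply, partialX_lagrangian]
  have : (fun t : ℝ => -(y + t • (Pi.single 2 1 : Fin 3 → ℝ)) 2 *
      partialX j (sigma A) x (y + t • (Pi.single 2 1 : Fin 3 → ℝ))) =
      fun t => -(y 2 + t) * partialX j (sigma A) x y := by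
    funext t
    rw [partialX_sigma_congr (y' := y) (by simp) (by simp)]
    simp
  simp only [partialY, lineDeriv, this]
  simp [deriv_mul_const_field']

theorem partialY_lagrangian (hσ : DifferentiableAt ℝ (Function.uncurry (sigma A)) (x, y))
    (l : Fin 3) :
    partialY l (lagrangian A ε) x y = (Pi.single l 1 : Fin 3 → ℝ) 0 -
      ((Pi.single l 1 : Fin 3 → ℝ) 2 * (sigma A x y - ε) + y 2 * partialY l (sigma A) x y) := by
  have hc : ∀ i : Fin 3, HasDerivAt (fun t : ℝ => (y + t • (Pi.single l 1 : Fin 3 → ℝ)) i)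
      ((Pi.single l 1 : Fin 3 → ℝ) i) 0 := by
    intro i
    simpa using ((hasDerivAt_id (0 : ℝ)).mul_const ((Pi.single l 1 : Fin 3 → ℝ) i)).const_add (y i)
  have h := (hc 0).sub ((hc 2).mul ((hasDerivAt_partialY hσ l).sub_const ε))
  have h' := h.deriv
  simp only [zero_smul, add_zero] at h'
  exact h'

theorem analyticAt_coord (p : EuclideanSpace ℝ (Fin d) × (Fin 3 → ℝ)) (i : Fin 3) :
    AnalyticAt ℝ (fun q : EuclideanSpace ℝ (Fin d) × (Fin 3 → ℝ) => q.2 i) p :=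
  ((ContinuousLinearMap.proj (R := ℝ) (φ := fun _ : Fin 3 => ℝ) i).comp
    (ContinuousLinearMap.snd ℝ (EuclideanSpace ℝ (Fin d)) (Fin 3 → ℝ))).analyticAt p

theorem analyticAt_lagrangian {p : EuclideanSpace ℝ (Fin d) × (Fin 3 → ℝ)}
    (hσ : AnalyticAt ℝ (Function.uncurry (sigma A)) p) :
    AnalyticAt ℝ (Function.uncurry (lagrangian A ε)) p :=
  (analyticAt_coord p 0).sub ((analyticAt_coord p 2).mul (hσ.sub analyticAt_const))

/-- `L + μ σ = z₁ + μ ε` is affine in `y`, so it has no second derivatives. -/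
theorem hessYY_lagrangian (hσ : AnalyticAt ℝ (Function.uncurry (sigma A)) (x, y)) (j l : Fin 3) :
    hessYY (lagrangian A ε) x y j l = -hessYY (fun x' y' => y' 2 * sigma A x' y') x y j l := by
  have h1 : ∀ᶠ y' in 𝓝 y, partialY j (lagrangian A ε) x y' =
      ((Pi.single j 1 : Fin 3 → ℝ) 0 + (Pi.single j 1 : Fin 3 → ℝ) 2 * ε) -
        partialY j (fun x' y' => y' 2 * sigma A x' y') x y' := by
    have ht : Tendsto (fun y' => (x, y')) (𝓝 y) (𝓝 (x, y)) :=
      continuousAt_const.prodMk continuousAt_id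
    filter_upwards [ht.eventually hσ.eventually_analyticAt] with y' hy'
    rw [partialY_lagrangian hy'.differentiableAt]
    have hc : HasDerivAt (fun t : ℝ => (y' + t • (Pi.single j 1 : Fin 3 → ℝ)) 2)
        ((Pi.single j 1 : Fin 3 → ℝ) 2) 0 := by
      simpa using
        ((hasDerivAt_id (0 : ℝ)).mul_const ((Pi.single j 1 : Fin 3 → ℝ) 2)).const_add (y' 2)
    have h := (hc.mul (hasDerivAt_partialY hy'.differentiableAt j)).deriv
    simp only [zero_smul, add_zero] at h
    have h' : partialY j (fun x' y' => y' 2 * sigma A x' y') x y' = _ := h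
    rw [h']
    ring
  have h2 : (fun y' => partialY j (lagrangian A ε) x y') =ᶠ[𝓝 y] _ := h1
  simp only [hessYY, of_apply]
  rw [partialY, h2.lineDeriv_eq]
  simp only [partialY, lineDeriv, deriv_const_sub]

end Lagrangian

/-! ### Analyticity and first derivatives of `σ(x, z)`. -/

section SigmaDerivatives

variable {d n : ℕ} {A : EuclideanSpace ℝ (Fin d) → Matrix (Fin n) (Fin n) ℂ}
  {x : EuclideanSpace ℝ (Fin d)}

theorem analyticAt_sigma [NeZero n] (hA : ∀ i j, AnalyticAt ℝ (fun x' => A x' i j) x)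
    {y : Fin 3 → ℝ} (hs : SigmaMinSimple (shifted A x ⟨y 0, y 1⟩)) (hpos : 0 < sigma A x y) :
    AnalyticAt ℝ (Function.uncurry (sigma A)) (x, y) := by
  refine analyticAt_sigmaMin
    (M := fun p : EuclideanSpace ℝ (Fin d) × (Fin 3 → ℝ) => shifted A p.1 ⟨p.2 0, p.2 1⟩)
    (fun i j => ?_) hs hpos
  simp only [shifted, Matrix.sub_apply, Matrix.smul_apply, smul_eq_mul]
  refine AnalyticAt.sub (AnalyticAt.fun_comp (g := fun x' => A x' i j) (f := Prod.fst) (hA i j)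
    analyticAt_fst) (AnalyticAt.mul ?_ analyticAt_const)
  have h : (fun p : EuclideanSpace ℝ (Fin d) × (Fin 3 → ℝ) => (⟨p.2 0, p.2 1⟩ : ℂ)) =
      fun p => (p.2 0 : ℂ) + (p.2 1 : ℂ) * Complex.I := by
    funext p
    exact Complex.mk_eq_add_mul_I _ _
  rw [h]
  have hc : ∀ i : Fin 3, AnalyticAt ℝ
      (fun q : EuclideanSpace ℝ (Fin d) × (Fin 3 → ℝ) => (q.2 i : ℂ)) (x, y) := fun i =>
    AnalyticAt.fun_comp (g := Complex.ofReal) (f := fun q : EuclideanSpace ℝ (Fin d) × (Fin 3 → ℝ) => q.2 i)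
      (Complex.ofRealCLM.analyticAt _) (analyticAt_coord _ i)
  exact (hc 0).add ((hc 1).mul analyticAt_const)

variable {y : Fin 3 → ℝ} {u v : Fin n → ℂ}

theorem partialX_sigma [NeZero n] (hA : ∀ i j, DifferentiableAt ℝ (fun x' => A x' i j) x)
    (hσ : DifferentiableAt ℝ (Function.uncurry (sigma A)) (x, y)) (hpos : 0 < sigma A x y)
    (huv : IsConsistentPair (shifted A x ⟨y 0, y 1⟩) u v) (j : Fin d) :
    partialX j (sigma A) x y = (star u ⬝ᵥ matPartial A j x *ᵥ v).re := by
  set e : EuclideanSpace ℝ (Fin d) := EuclideanSpace.single j 1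
  have h0 : x + (0 : ℝ) • e = x := by simp
  refine deriv_sigmaMin (M := fun t : ℝ => shifted A (x + t • e) ⟨y 0, y 1⟩)
    (fun p q => ?_) (by simpa only [h0, sigma] using hpos) ?_ (by simpa only [h0] using huv)
  · simp only [shifted, Matrix.sub_apply]
    refine HasDerivAt.sub_const _ ?_
    exact ((hA p q).hasFDerivAt.hasLineDerivAt e).lineDifferentiableAt.hasLineDerivAt
  · have h1 : DifferentiableAt ℝ (fun t : ℝ => (x + t • e, y)) 0 := by fun_prop
    have h2 : DifferentiableAt ℝ (Function.uncurry (sigma A)) (x + (0 : ℝ) • e, y) := by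
      rwa [h0]
    exact (h2.hasFDerivAt.comp_hasDerivAt (0 : ℝ) h1.hasDerivAt).differentiableAt

/-- Moving along a coordinate of `y` perturbs the matrix by `-c I`, with `c = 1`, `i`, `0` for `z₁`,
`z₂`, `μ`. -/
theorem partialY_sigma_eq [NeZero n]
    (hσ : DifferentiableAt ℝ (Function.uncurry (sigma A)) (x, y)) (hpos : 0 < sigma A x y)
    (huv : IsConsistentPair (shifted A x ⟨y 0, y 1⟩) u v) (l : Fin 3) :
    partialY l (sigma A) x y =
      -((⟨(Pi.single l 1 : Fin 3 → ℝ) 0, (Pi.single l 1 : Fin 3 → ℝ) 1⟩ : ℂ) *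
        (star u ⬝ᵥ v)).re := by
  set e : Fin 3 → ℝ := Pi.single l 1
  have h0 : y + (0 : ℝ) • e = y := by simp
  set c : ℂ := ⟨e 0, e 1⟩ with hc
  have h := deriv_sigmaMin
    (M := fun t : ℝ => shifted A x ⟨(y + t • e) 0, (y + t • e) 1⟩)
    (M' := -(c • (1 : Matrix (Fin n) (Fin n) ℂ))) (t := 0)
    (fun p q => ?_) (by simpa only [h0, sigma] using hpos) ?_ (u := u) (v := v)
    (by simpa only [h0] using huv)
  · have h2 : partialY l (sigma A) x y = _ := h
    rw [h2, neg_mulVec, smul_mulVec, one_mulVec, dotProduct_neg, dotProduct_smul, smul_eq_mul,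
      Complex.neg_re]
  · have h1 : (fun t : ℝ => (⟨(y + t • e) 0, (y + t • e) 1⟩ : ℂ)) =
        fun t : ℝ => (⟨y 0, y 1⟩ : ℂ) + t * c := by
      funext t
      apply Complex.ext <;> simp [hc]
    have h2 : HasDerivAt (fun t : ℝ => (⟨(y + t • e) 0, (y + t • e) 1⟩ : ℂ)) c 0 := by
      rw [h1]
      simpa using ((Complex.ofRealCLM.hasDerivAt (x := (0 : ℝ))).mul_const c).const_add
        (⟨y 0, y 1⟩ : ℂ)
    simp only [shifted, Matrix.sub_apply, Matrix.smul_apply, Matrix.neg_apply, smul_eq_mul]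
    exact (h2.mul_const _).const_sub _
  · exact (hasDerivAt_partialY hσ l).differentiableAt

theorem partialY_zero_sigma [NeZero n]
    (hσ : DifferentiableAt ℝ (Function.uncurry (sigma A)) (x, y)) (hpos : 0 < sigma A x y)
    (huv : IsConsistentPair (shifted A x ⟨y 0, y 1⟩) u v) :
    partialY 0 (sigma A) x y = -(star u ⬝ᵥ v).re := by
  rw [partialY_sigma_eq hσ hpos huv]
  simp

theorem partialY_one_sigma [NeZero n]
    (hσ : DifferentiableAt ℝ (Function.uncurry (sigma A)) (x, y)) (hpos : 0 < sigma A x y)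
    (huv : IsConsistentPair (shifted A x ⟨y 0, y 1⟩) u v) :
    partialY 1 (sigma A) x y = (star u ⬝ᵥ v).im := by
  rw [partialY_sigma_eq hσ hpos huv]
  simp

end SigmaDerivatives

/-! ### Rightmost points: existence, optimality conditions and stability. -/

section RightmostPoints

variable {d n : ℕ} {A : EuclideanSpace ℝ (Fin d) → Matrix (Fin n) (Fin n) ℂ} {ε : ℝ}
  {x : EuclideanSpace ℝ (Fin d)} {z : ℂ}

theorem continuousAt_sigmaMin_shifted [NeZero n] (hA : ContinuousAt A x) (z : ℂ) :
    ContinuousAt (fun p : EuclideanSpace ℝ (Fin d) × ℂ => sigmaMin (shifted A p.1 p.2)) (x, z) := by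
  refine continuous_sigmaMin.continuousAt.comp ?_
  refine ContinuousAt.sub ?_ (continuousAt_snd.smul continuousAt_const)
  exact ContinuousAt.comp (f := Prod.fst) hA continuousAt_fst

theorem continuous_sigmaMin_shifted [NeZero n] (A : EuclideanSpace ℝ (Fin d) →
    Matrix (Fin n) (Fin n) ℂ) (x : EuclideanSpace ℝ (Fin d)) :
    Continuous fun z : ℂ => sigmaMin (shifted A x z) :=
  continuous_sigmaMin.comp (continuous_const.sub (continuous_id.smul continuous_const))

/-- Write `z v = A v - (A - z) v` for a minimising unit vector. The bound is locally uniform in `x`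
when `A` is continuous. -/
theorem norm_le_of_mem_pseudospectrum [NeZero n] (hz : z ∈ pseudospectrum A ε x) :
    ‖z‖ ≤ ε + ‖toEuclideanCLM (𝕜 := ℂ) (A x)‖ := by
  obtain ⟨v, hv, h⟩ := exists_norm_one_eigenvector (shifted A x z)
  have h1 := norm_eq_sigmaMin_of_eigenvector _ hv h
  have h2 : z • v = toEuclideanCLM (𝕜 := ℂ) (A x) v - toEuclideanLin (shifted A x z) v := by
    rw [shifted, toEuclideanLin_sub_smul, Algebra.algebraMap_eq_smul_one]
    simp
  have h3 := norm_sub_le (toEuclideanCLM (𝕜 := ℂ) (A x) v) (toEuclideanLin (shifted A x z) v)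
  have h4 := (toEuclideanCLM (𝕜 := ℂ) (A x)).le_opNorm v
  rw [← h2, norm_smul, hv, mul_one, h1] at h3
  rw [hv, mul_one] at h4
  have h5 : sigmaMin (shifted A x z) ≤ ε := hz
  linarith

theorem exists_isRightmost [NeZero n] (hne : (pseudospectrum A ε x).Nonempty) :
    ∃ z, IsRightmost A ε x z := by
  have hc : IsCompact (pseudospectrum A ε x) := by
    refine Metric.isCompact_of_isClosed_isBounded
      (isClosed_le (continuous_sigmaMin_shifted A x) continuous_const) ?_
    exact isBounded_iff_forall_norm_le.2 ⟨_, fun z hz => norm_le_of_mem_pseudospectrum hz⟩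
  obtain ⟨z, hz, hmax⟩ := hc.exists_isMaxOn hne Complex.continuous_re.continuousOn
  exact ⟨z, hz, fun w hw => hmax hw⟩

theorem IsRightmost.abscissa_eq (hz : IsRightmost A ε x z) : abscissa A ε x = z.re := by
  refine IsGreatest.csSup_eq ⟨Set.mem_image_of_mem _ hz.1, ?_⟩
  rintro _ ⟨w, hw, rfl⟩
  exact hz.2 w hw

theorem IsRightmost.lt_sigmaMin (hz : IsRightmost A ε x z) {w : ℂ} (hw : z.re < w.re) :
    ε < sigmaMin (shifted A x w) := by
  by_contra! h
  exact (hz.2 w h).not_gt hw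

/-- The constraint is active: points just to the right have `σ > ε`, and `σ` is continuous. -/
theorem IsRightmost.sigmaMin_eq [NeZero n] (hz : IsRightmost A ε x z) :
    sigmaMin (shifted A x z) = ε := by
  refine le_antisymm hz.1 ?_
  have h1 : Tendsto (fun t : ℝ => z + t) (𝓝[>] 0) (𝓝 z) := by
    have h : Continuous (fun t : ℝ => z + t) := by fun_prop
    have h2 := h.tendsto 0
    simp only [Complex.ofReal_zero, add_zero] at h2
    exact h2.mono_left nhdsWithin_le_nhds
  refine ge_of_tendsto (((continuous_sigmaMin_shifted A x).tendsto z).comp h1) ?_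
  filter_upwards [self_mem_nhdsWithin] with t ht
  refine (hz.lt_sigmaMin ?_).le
  have : 0 < t := ht
  simpa using this

theorem sigma_mkY (μ : ℝ) : sigma A x (mkY z μ) = sigmaMin (shifted A x z) := rfl

/-- First-order necessary condition at a rightmost point: `σ` does not decrease in any direction
pointing to the right. -/
theorem IsRightmost.directional_nonneg [NeZero n] (hz : IsRightmost A ε x z) {μ : ℝ}
    (hσ : DifferentiableAt ℝ (Function.uncurry (sigma A)) (x, mkY z μ)) {a b : ℝ} (ha : 0 < a) :
    0 ≤ partialY 0 (sigma A) x (mkY z μ) * a + partialY 1 (sigma A) x (mkY z μ) * b := by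
  have h := hasDerivAt_line_snd hσ ![a, b, 0]
  simp only [Fin.sum_univ_three, Matrix.cons_val_zero, Matrix.cons_val_one, Matrix.cons_val,
    mul_zero, add_zero] at h
  have hs := (hasDerivWithinAt_iff_tendsto_slope' Set.self_notMem_Ioi).1
    (h.hasDerivWithinAt (s := Set.Ioi 0))
  refine ge_of_tendsto hs ?_
  filter_upwards [self_mem_nhdsWithin] with t ht
  have ht0 : 0 < t := ht
  rw [slope_def_field, sub_zero]
  refine div_nonneg (sub_nonneg.2 ?_) ht0.le
  rw [zero_smul, add_zero, sigma_mkY, hz.sigmaMin_eq]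
  refine (hz.lt_sigmaMin ?_).le
  simpa [mkY] using mul_pos ht0 ha

theorem IsRightmost.partialY_zero_nonneg [NeZero n] (hz : IsRightmost A ε x z) {μ : ℝ}
    (hσ : DifferentiableAt ℝ (Function.uncurry (sigma A)) (x, mkY z μ)) :
    0 ≤ partialY 0 (sigma A) x (mkY z μ) := by
  simpa using hz.directional_nonneg hσ (b := 0) one_pos

theorem IsRightmost.partialY_one_eq_zero [NeZero n] (hz : IsRightmost A ε x z) {μ : ℝ}
    (hσ : DifferentiableAt ℝ (Function.uncurry (sigma A)) (x, mkY z μ)) :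
    partialY 1 (sigma A) x (mkY z μ) = 0 := by
  by_contra hne
  -- This `b` makes the derivative in the direction `(1, b)` equal to `-1`.
  have h := hz.directional_nonneg hσ one_pos
    (b := -(partialY 0 (sigma A) x (mkY z μ) + 1) / partialY 1 (sigma A) x (mkY z μ))
  rw [mul_div_cancel₀ _ hne] at h
  linarith

/-- Rightmost points are stable under perturbation, when the rightmost point is unique and is a
limit of points of the interior of the pseudospectrum. -/
theorem eventually_isRightmost_mem [NeZero n] (hA : ContinuousAt A x)
    (huniq : ∀ w, IsRightmost A ε x w → w = z) (hz : IsRightmost A ε x z)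
    (hint : ∀ η > 0, ∃ w : ℂ, z.re - η < w.re ∧ sigmaMin (shifted A x w) < ε)
    {U : Set ℂ} (hU : U ∈ 𝓝 z) :
    ∀ᶠ x' in 𝓝 x, (∃ w, IsRightmost A ε x' w) ∧ ∀ w, IsRightmost A ε x' w → w ∈ U := by
  set r : ℝ := ε + (‖toEuclideanCLM (𝕜 := ℂ) (A x)‖ + 1) with hr
  have hbound : ∀ᶠ x' in 𝓝 x, ∀ w ∈ pseudospectrum A ε x', ‖w‖ ≤ r := by
    have hc : ContinuousAt (fun x' => ‖toEuclideanCLM (𝕜 := ℂ) (A x')‖) x :=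
      (continuous_toEuclideanCLM.continuousAt.comp hA).norm
    filter_upwards [hc.eventually (gt_mem_nhds (lt_add_one _))] with x' hx' w hw
    have := norm_le_of_mem_pseudospectrum hw
    rw [hr]
    linarith
  set K : Set ℂ := Metric.closedBall 0 r \ interior U with hK
  have hKc : IsCompact K := (isCompact_closedBall 0 r).diff isOpen_interior
  -- Away from `U`, a point is infeasible or strictly left of `z`, else it would be a second
  -- rightmost point. Treating the margin `η` as a parameter next to `x'` lets compactness of `K`
  -- make both alternatives uniform.
  have htube : ∀ᶠ q : EuclideanSpace ℝ (Fin d) × ℝ in 𝓝 (x, 0), ∀ w ∈ K,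
      ε < sigmaMin (shifted A q.1 w) ∨ w.re < z.re - q.2 := by
    refine hKc.eventually_forall_of_forall_eventually
      (P := fun (q : EuclideanSpace ℝ (Fin d) × ℝ) w =>
        ε < sigmaMin (shifted A q.1 w) ∨ w.re < z.re - q.2) fun w hw => ?_
    have hw' : ε < sigmaMin (shifted A x w) ∨ w.re < z.re - 0 := by
      by_contra! hcon
      rw [sub_zero] at hcon
      have h1 : IsRightmost A ε x w := ⟨hcon.1, fun w' hw' => (hz.2 w' hw').trans hcon.2⟩
      exact hw.2 (huniq w h1 ▸ mem_interior_iff_mem_nhds.2 hU)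
    rcases hw' with h | h
    · have hc : ContinuousAt (fun s : (EuclideanSpace ℝ (Fin d) × ℝ) × ℂ =>
          sigmaMin (shifted A s.1.1 s.2)) ((x, 0), w) :=
        ContinuousAt.comp (g := fun p : EuclideanSpace ℝ (Fin d) × ℂ =>
          sigmaMin (shifted A p.1 p.2))
          (f := fun s : (EuclideanSpace ℝ (Fin d) × ℝ) × ℂ => (s.1.1, s.2))
          (continuousAt_sigmaMin_shifted hA w) (by fun_prop)
      exact (hc.eventually (lt_mem_nhds h)).mono fun s hs => Or.inl hs
    · have hc : Continuous (fun s : (EuclideanSpace ℝ (Fin d) × ℝ) × ℂ =>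
          (z.re - s.1.2) - s.2.re) := by fun_prop
      have h0 : 0 < (z.re - 0) - w.re := sub_pos.2 h
      exact ((hc.tendsto ((x, 0), w)).eventually (lt_mem_nhds h0)).mono
        fun s hs => Or.inr (sub_pos.1 hs)
  rw [nhds_prod_eq, eventually_prod_iff] at htube
  obtain ⟨pa, hpa, pb, hpb, hab⟩ := htube
  obtain ⟨η, hη, hη0⟩ : ∃ η, pb η ∧ 0 < η :=
    ((hpb.filter_mono nhdsWithin_le_nhds).and (self_mem_nhdsWithin (s := Set.Ioi (0 : ℝ)))).exists
  -- A strictly feasible point stays feasible for nearby `x'`, and it beats everything left of `z.re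
  -- - η`.
  obtain ⟨w, hw, hwσ⟩ := hint η hη0
  have hwev : ∀ᶠ x' in 𝓝 x, sigmaMin (shifted A x' w) < ε := by
    have hc : ContinuousAt (fun x' => sigmaMin (shifted A x' w)) x :=
      ContinuousAt.comp (g := fun p : EuclideanSpace ℝ (Fin d) × ℂ =>
        sigmaMin (shifted A p.1 p.2)) (f := fun x' => (x', w))
        (continuousAt_sigmaMin_shifted hA w) (by fun_prop)
    exact hc.eventually (gt_mem_nhds hwσ)
  filter_upwards [hpa, hwev, hbound] with x' h1 h2 h3
  refine ⟨exists_isRightmost ⟨w, h2.le⟩, fun w' hw' => ?_⟩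
  by_contra hnU
  have hwK : w' ∈ K := ⟨by simpa using h3 w' hw'.1, fun hi => hnU (interior_subset hi)⟩
  rcases hab h1 hη w' hwK with h4 | h4
  · exact h4.not_ge hw'.1
  · have := hw'.2 w h2.le
    simp only at h4
    linarith

end RightmostPoints

/-! ### The multiplier, the analytic branch and the abscissa. -/

section MainTheorem

variable {d n : ℕ} {A : EuclideanSpace ℝ (Fin d) → Matrix (Fin n) (Fin n) ℂ} {ε : ℝ}
  {x : EuclideanSpace ℝ (Fin d)} {z : ℂ}

theorem analyticAt_matFun_apply {κ : ℕ} {f : Fin κ → EuclideanSpace ℝ (Fin d) → ℝ}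
    (hf : ∀ i, AnalyticAt ℝ (f i) x) (As : Fin κ → Matrix (Fin n) (Fin n) ℂ) (p q : Fin n) :
    AnalyticAt ℝ (fun x' => matFun f As x' p q) x := by
  simp only [matFun, Matrix.sum_apply, Matrix.smul_apply, smul_eq_mul]
  refine Finset.analyticAt_fun_sum _ fun i _ => AnalyticAt.mul ?_ analyticAt_const
  exact AnalyticAt.fun_comp (g := Complex.ofReal) (f := f i) (Complex.ofRealCLM.analyticAt _) (hf i)

theorem continuous_mkY : Continuous fun q : ℂ × ℝ => mkY q.1 q.2 := by
  refine continuous_pi fun i => ?_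
  fin_cases i
  · exact Complex.continuous_re.comp continuous_fst
  · exact Complex.continuous_im.comp continuous_fst
  · exact continuous_snd

theorem neZero_of_sigmaMinSimple {M : Matrix (Fin n) (Fin n) ℂ} (hM : SigmaMinSimple M) :
    NeZero n := by
  obtain ⟨i, -⟩ := hM.exists
  exact ⟨fun h => (Fin.cast h i).elim0⟩

theorem IsRightmost.partialY_lagrangian_eq_zero [NeZero n] (hz : IsRightmost A ε x z) {μ : ℝ}
    (hσ : DifferentiableAt ℝ (Function.uncurry (sigma A)) (x, mkY z μ))
    (hμ : μ * partialY 0 (sigma A) x (mkY z μ) = 1) (l : Fin 3) :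
    partialY l (lagrangian A ε) x (mkY z μ) = 0 := by
  have h2 : mkY z μ 2 = μ := rfl
  rw [partialY_lagrangian hσ, h2, sigma_mkY, hz.sigmaMin_eq, sub_self, mul_zero, zero_add]
  fin_cases l
  · simp [hμ]
  · simp [hz.partialY_one_eq_zero hσ]
  · simp [partialY_two_sigma]

/-- The left and right singular vectors at a rightmost point with simple singular value have a
negative real inner product. -/
theorem IsRightmost.dotProduct_re_neg [NeZero n] (hz : IsRightmost A ε x z) (hε : 0 < ε) {μ : ℝ}
    (hσ : DifferentiableAt ℝ (Function.uncurry (sigma A)) (x, mkY z μ))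
    {u v : Fin n → ℂ} (huv : IsConsistentPair (shifted A x z) u v) :
    (star u ⬝ᵥ v).im = 0 ∧ (star u ⬝ᵥ v).re < 0 ∧
      partialY 0 (sigma A) x (mkY z μ) = -(star u ⬝ᵥ v).re := by
  have hpos : 0 < sigma A x (mkY z μ) := by rw [sigma_mkY, hz.sigmaMin_eq]; exact hε
  have hne : star u ⬝ᵥ v ≠ 0 :=
    dotProduct_ne_zero_of_rightmost hε hz.sigmaMin_eq (fun w hw => hz.lt_sigmaMin hw) huv
  have h0 := partialY_zero_sigma hσ hpos huv
  have him : (star u ⬝ᵥ v).im = 0 :=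
    (partialY_one_sigma hσ hpos huv).symm.trans (hz.partialY_one_eq_zero hσ)
  refine ⟨him, lt_of_le_of_ne ?_ fun h => hne (Complex.ext h him), h0⟩
  have := hz.partialY_zero_nonneg hσ
  linarith

/-- As `σ_{z₁} > 0`, a small step to the left brings `σ` below `ε`; this supplies the strict
feasibility needed for stability. -/
theorem IsRightmost.exists_sigmaMin_lt [NeZero n] (hz : IsRightmost A ε x z) {μ : ℝ}
    (hσ : DifferentiableAt ℝ (Function.uncurry (sigma A)) (x, mkY z μ))
    (hpos : 0 < partialY 0 (sigma A) x (mkY z μ)) {η : ℝ} (hη : 0 < η) :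
    ∃ w : ℂ, z.re - η < w.re ∧ sigmaMin (shifted A x w) < ε := by
  have h := hasDerivAt_partialY hσ 0
  have hs := (hasDerivWithinAt_iff_tendsto_slope' Set.self_notMem_Iio).1
    (h.hasDerivWithinAt (s := Set.Iio 0))
  have hη' : ∀ᶠ t : ℝ in 𝓝[<] 0, -η < t :=
    (lt_mem_nhds (neg_lt_zero.2 hη)).filter_mono nhdsWithin_le_nhds
  obtain ⟨t, ⟨h1, h2⟩, ht⟩ := (((hs.eventually (lt_mem_nhds hpos)).and hη').and
    self_mem_nhdsWithin).exists
  have ht0 : t < 0 := ht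
  rw [slope_def_field, sub_zero, zero_smul, add_zero, sigma_mkY, hz.sigmaMin_eq] at h1
  set y := mkY z μ + t • (Pi.single 0 1 : Fin 3 → ℝ) with hy
  refine ⟨⟨y 0, y 1⟩, ?_, ?_⟩
  · have : y 0 = z.re + t := by
      rw [hy, Pi.add_apply, Pi.smul_apply, Pi.single_eq_same, smul_eq_mul, mul_one]
      rfl
    rw [this]
    linarith
  · by_contra! hcon
    exact h1.not_ge (div_nonpos_of_nonneg_of_nonpos (sub_nonneg.2 hcon) ht0.le)

/-- Near a nondegenerate point the abscissa is the first coordinate of an analytic curve of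
stationary points of the Lagrangian. -/
theorem exists_analytic_stationary_abscissa [NeZero n] (hA : ContinuousAt A x)
    (huniq : ∀ w, IsRightmost A ε x w → w = z) (hz : IsRightmost A ε x z) {μ : ℝ}
    (hσ : AnalyticAt ℝ (Function.uncurry (sigma A)) (x, mkY z μ))
    (hpos : 0 < partialY 0 (sigma A) x (mkY z μ))
    (hμ : μ = (partialY 0 (sigma A) x (mkY z μ))⁻¹)
    (hu : IsUnit (hessYY (lagrangian A ε) x (mkY z μ))) :
    ∃ Y : EuclideanSpace ℝ (Fin d) → Fin 3 → ℝ, AnalyticAt ℝ Y x ∧ Y x = mkY z μ ∧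
      (∀ᶠ x' in 𝓝 x, ∀ l, partialY l (lagrangian A ε) x' (Y x') = 0) ∧
      abscissa A ε =ᶠ[𝓝 x] (fun x' => Y x' 0) ∧
      abscissa A ε =ᶠ[𝓝 x] fun x' => lagrangian A ε x' (Y x') := by
  have hL : AnalyticAt ℝ (Function.uncurry (lagrangian A ε)) (x, mkY z μ) :=
    analyticAt_lagrangian hσ
  have hst : ∀ l, partialY l (lagrangian A ε) x (mkY z μ) = 0 :=
    hz.partialY_lagrangian_eq_zero hσ.differentiableAt
      (by nth_rewrite 1 [hμ]; exact inv_mul_cancel₀ hpos.ne')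
  obtain ⟨Y, hY, hYx, hYst, hYu⟩ := exists_analytic_stationary hL hst hu
  have hm : ContinuousAt (fun p : EuclideanSpace ℝ (Fin d) × ℂ => (p.1, mkY p.2 μ)) (x, z) :=
    continuousAt_fst.prodMk
      (continuous_mkY.comp (continuous_snd.prodMk continuous_const)).continuousAt
  have hD : ContinuousAt (fun p : EuclideanSpace ℝ (Fin d) × ℂ =>
      partialY 0 (sigma A) p.1 (mkY p.2 μ)) (x, z) :=
    ContinuousAt.comp (g := Function.uncurry (partialY 0 (sigma A)))
      (f := fun p : EuclideanSpace ℝ (Fin d) × ℂ => (p.1, mkY p.2 μ))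
      (analyticAt_partialY 0 hσ).continuousAt hm
  -- `Ψ` attaches to each `(x', w)` the candidate multiplier `1/σ_{z₁}`. By continuity its values
  -- lie where stationary points are unique, so nearby rightmost points fall on the branch `Y`.
  set Ψ : EuclideanSpace ℝ (Fin d) × ℂ → EuclideanSpace ℝ (Fin d) × (Fin 3 → ℝ) :=
    fun p => (p.1, mkY p.2 (partialY 0 (sigma A) p.1 (mkY p.2 μ))⁻¹) with hΨ
  have hΨt : Tendsto Ψ (𝓝 (x, z)) (𝓝 (x, mkY z μ)) := by
    have h1 : ContinuousAt Ψ (x, z) :=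
      continuousAt_fst.prodMk (ContinuousAt.comp (g := fun q : ℂ × ℝ => mkY q.1 q.2)
        continuous_mkY.continuousAt (continuousAt_snd.prodMk (hD.inv₀ hpos.ne')))
    have h2 : Ψ (x, z) = (x, mkY z μ) := by
      simp only [hΨ]
      rw [← hμ]
    rw [← h2]
    exact h1
  have hev := ((hΨt.eventually hYu).and (hΨt.eventually hσ.eventually_analyticAt)).and
    (hD.eventually (lt_mem_nhds hpos))
  rw [nhds_prod_eq, eventually_prod_iff] at hev
  obtain ⟨pa, hpa, pb, hpb, hab⟩ := hev
  have hα : abscissa A ε =ᶠ[𝓝 x] fun x' => Y x' 0 := by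
    filter_upwards [hpa, eventually_isRightmost_mem hA huniq hz
      (fun η hη => hz.exists_sigmaMin_lt hσ.differentiableAt hpos hη) hpb] with x' h1 h2
    obtain ⟨⟨w, hw⟩, h3⟩ := h2
    obtain ⟨⟨h4, h5⟩, h6⟩ := hab h1 (h3 w hw)
    rw [hw.abscissa_eq]
    have h7 := h4 (hw.partialY_lagrangian_eq_zero h5.differentiableAt (by
      rw [partialY_sigma_congr (y' := mkY w μ) rfl rfl]
      exact inv_mul_cancel₀ (ne_of_gt h6)))
    exact (congrFun h7 0).symm
  refine ⟨Y, hY, hYx, hYst, hα, ?_⟩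
  have hg : Tendsto (fun x' => (x', Y x')) (𝓝 x) (𝓝 (x, mkY z μ)) := by
    rw [← hYx]
    exact continuousAt_id.prodMk hY.continuousAt
  filter_upwards [hα, hYst, hg.eventually hσ.eventually_analyticAt] with x' h1 h2 h3
  -- Stationarity in `μ` is the active constraint `σ = ε`, so the Lagrangian reduces to `z₁` on the
  -- branch.
  have h4 := h2 2
  rw [partialY_lagrangian h3.differentiableAt, partialY_two_sigma] at h4
  simp only [Pi.single_eq_same, mul_zero, add_zero, one_mul] at h4
  have h5 : sigma A x' (Y x') - ε = 0 := by
    rw [Pi.single_eq_of_ne (by decide), zero_sub, neg_eq_zero] at h4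
    exact h4
  rw [h1, lagrangian, h5, mul_zero, sub_zero]

theorem hasGradientAt_of_lineDeriv {g : EuclideanSpace ℝ (Fin d) → ℝ} (hg : DifferentiableAt ℝ g x)
    {c : Fin d → ℝ} (hc : ∀ j, lineDeriv ℝ g x (EuclideanSpace.single j 1) = c j) :
    HasGradientAt g (WithLp.toLp 2 c) x := by
  rw [hasGradientAt_iff_hasFDerivAt]
  have h : fderiv ℝ g x = InnerProductSpace.toDual ℝ _ (WithLp.toLp 2 c) := by
    refine ContinuousLinearMap.coe_inj.1 ?_
    refine (EuclideanSpace.basisFun (Fin d) ℝ).toBasis.ext fun j => ?_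
    have := hc j
    rw [hg.lineDeriv_eq_fderiv] at this
    simpa [EuclideanSpace.inner_single_right] using this
  rw [← h]
  exact hg.hasFDerivAt

end MainTheorem

end PsAbscissa

theorem theorem2p3 {d n κ : ℕ} (Ω : Set (EuclideanSpace ℝ (Fin d))) (hΩ : IsOpen Ω)
    (f : Fin κ → EuclideanSpace ℝ (Fin d) → ℝ) (hf : ∀ i, AnalyticOnNhd ℝ (f i) Ω)
    (As : Fin κ → Matrix (Fin n) (Fin n) ℂ)
    (A : EuclideanSpace ℝ (Fin d) → Matrix (Fin n) (Fin n) ℂ)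
    (hA : A = PsAbscissa.matFun f As)
    (ε : ℝ) (hε : 0 < ε)
    (x : EuclideanSpace ℝ (Fin d)) (hx : x ∈ Ω) (hnd : PsAbscissa.Nondegenerate A ε x) :
    AnalyticAt ℝ (PsAbscissa.abscissa A ε) x ∧
    ∃ (z : ℂ) (μ : ℝ),
      -- `z = z(x)` and `μ = μ(x)`
      PsAbscissa.IsRightmost A ε x z ∧
      PsAbscissa.IsMultiplier A ε x z μ ∧
      (∀ μ' : ℝ, PsAbscissa.IsMultiplier A ε x z μ' → μ' = μ) ∧
      -- the derivatives of the Lagrangian below exist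
      AnalyticAt ℝ (fun p : EuclideanSpace ℝ (Fin d) × (Fin 3 → ℝ) =>
        PsAbscissa.lagrangian A ε p.1 p.2) (x, PsAbscissa.mkY z μ) ∧
      -- the gradient, and the value of the multiplier
      (∀ u v : Fin n → ℂ, PsAbscissa.IsConsistentPair (PsAbscissa.shifted A x z) u v →
        star u ⬝ᵥ v ≠ 0 ∧
        HasGradientAt (PsAbscissa.abscissa A ε)
          (WithLp.toLp 2 fun j : Fin d =>
            ((star u ⬝ᵥ Matrix.mulVec (PsAbscissa.matPartial A j x) v) / (star u ⬝ᵥ v)).re) x ∧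
        (μ : ℂ) = -1 / (star u ⬝ᵥ v)) ∧
      -- the Hessian
      IsUnit (PsAbscissa.hessYY (PsAbscissa.lagrangian A ε) x (PsAbscissa.mkY z μ)) ∧
      PsAbscissa.hessian (PsAbscissa.abscissa A ε) x =
        PsAbscissa.hessXX (PsAbscissa.lagrangian A ε) x (PsAbscissa.mkY z μ) -
          PsAbscissa.hessXY (PsAbscissa.lagrangian A ε) x (PsAbscissa.mkY z μ) *
          (PsAbscissa.hessYY (PsAbscissa.lagrangian A ε) x (PsAbscissa.mkY z μ))⁻¹ *
          (PsAbscissa.hessXY (PsAbscissa.lagrangian A ε) x (PsAbscissa.mkY z μ)).transpose ∧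
      -- the entries of the three blocks
      (∀ j l : Fin d,
        PsAbscissa.hessXX (PsAbscissa.lagrangian A ε) x (PsAbscissa.mkY z μ) j l =
          -μ * PsAbscissa.hessXX (PsAbscissa.sigma A) x (PsAbscissa.mkY z μ) j l) ∧
      (∀ (j : Fin d) (l : Fin 3), l ≠ 2 →
        PsAbscissa.hessXY (PsAbscissa.lagrangian A ε) x (PsAbscissa.mkY z μ) j l =
          -μ * PsAbscissa.hessXY (PsAbscissa.sigma A) x (PsAbscissa.mkY z μ) j l) ∧
      (∀ j : Fin d,
        PsAbscissa.hessXY (PsAbscissa.lagrangian A ε) x (PsAbscissa.mkY z μ) j 2 =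
          -PsAbscissa.partialX j (PsAbscissa.sigma A) x (PsAbscissa.mkY z μ)) ∧
      (∀ j l : Fin 3,
        PsAbscissa.hessYY (PsAbscissa.lagrangian A ε) x (PsAbscissa.mkY z μ) j l =
          -PsAbscissa.hessYY (fun x' y' => y' 2 * PsAbscissa.sigma A x' y') x
            (PsAbscissa.mkY z μ) j l) := by
  have hAn : ∀ p q, AnalyticAt ℝ (fun x' => A x' p q) x := by
    rw [hA]
    exact PsAbscissa.analyticAt_matFun_apply (fun i => hf i x hx) As
  have hAc : ContinuousAt A x :=
    continuousAt_pi.2 fun i => continuousAt_pi.2 fun j => (hAn i j).continuousAt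
  obtain ⟨⟨z, hz, huniq⟩, hsimple, hunit⟩ := hnd
  have : NeZero n := PsAbscissa.neZero_of_sigmaMinSimple (hsimple z hz)
  have hσ : ∀ μ, AnalyticAt ℝ (Function.uncurry (PsAbscissa.sigma A)) (x, PsAbscissa.mkY z μ) :=
    fun μ => PsAbscissa.analyticAt_sigma hAn (hsimple z hz) (by
      rw [PsAbscissa.sigma_mkY, hz.sigmaMin_eq]; exact hε)
  set D := PsAbscissa.partialY 0 (PsAbscissa.sigma A) x (PsAbscissa.mkY z 0) with hDdef
  have hD : ∀ μ, PsAbscissa.partialY 0 (PsAbscissa.sigma A) x (PsAbscissa.mkY z μ) = D :=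
    fun μ => PsAbscissa.partialY_sigma_congr rfl rfl 0
  obtain ⟨u₀, v₀, huv₀⟩ := PsAbscissa.exists_isConsistentPair (PsAbscissa.shifted A x z)
    (by rw [hz.sigmaMin_eq]; exact hε)
  have hDpos : 0 < D := by
    obtain ⟨-, h1, h2⟩ := hz.dotProduct_re_neg hε (hσ 0).differentiableAt huv₀
    rw [hDdef, h2]
    linarith
  have hst : ∀ l, PsAbscissa.partialY l (PsAbscissa.lagrangian A ε) x
      (PsAbscissa.mkY z D⁻¹) = 0 :=
    hz.partialY_lagrangian_eq_zero (hσ _).differentiableAt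
      (by rw [hD]; exact inv_mul_cancel₀ hDpos.ne')
  have hmult : PsAbscissa.IsMultiplier A ε x z D⁻¹ := by
    refine ⟨(inv_pos.2 hDpos).le, hst 0, hst 1, ?_⟩
    rw [PsAbscissa.sigma_mkY, hz.sigmaMin_eq, sub_self, mul_zero]
  -- Nondegeneracy gives nonsingularity only at a multiplier, so one had to be constructed
  -- beforehand.
  have hu := hunit z D⁻¹ hz hmult
  have hL : AnalyticAt ℝ (Function.uncurry (PsAbscissa.lagrangian A ε))
      (x, PsAbscissa.mkY z D⁻¹) := PsAbscissa.analyticAt_lagrangian (hσ _)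
  obtain ⟨Y, hY, hYx, hYst, hα0, hαL⟩ :=
    PsAbscissa.exists_analytic_stationary_abscissa hAc huniq hz (hσ D⁻¹)
      (by rw [hD]; exact hDpos) (by rw [hD]) hu
  have hαan : AnalyticAt ℝ (PsAbscissa.abscissa A ε) x :=
    (analyticAt_pi_iff.1 hY 0).congr hα0.symm
  have hLY : AnalyticAt ℝ (Function.uncurry (PsAbscissa.lagrangian A ε)) (x, Y x) := by
    rw [hYx]; exact hL
  refine ⟨hαan, z, D⁻¹, hz, hmult, ?_, hL, ?_, hu, ?_,
    fun j l => PsAbscissa.hessXX_lagrangian j l,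
    fun j l hl => PsAbscissa.hessXY_lagrangian_of_ne j hl,
    fun j => PsAbscissa.hessXY_lagrangian_two j,
    fun j l => PsAbscissa.hessYY_lagrangian (hσ _) j l⟩
  · rintro μ' ⟨-, h1, -, -⟩
    rw [PsAbscissa.partialY_lagrangian (hσ μ').differentiableAt, hD] at h1
    have h2 : PsAbscissa.mkY z μ' 2 = μ' := rfl
    rw [h2] at h1
    have h3 : 1 - μ' * D = 0 := by simpa using h1
    exact eq_inv_of_mul_eq_one_left (by linarith)
  · intro u v huv
    obtain ⟨him, hre, hDre⟩ := hz.dotProduct_re_neg hε (hσ D⁻¹).differentiableAt huv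
    rw [hD] at hDre
    have hs : star u ⬝ᵥ v = ((-D : ℝ) : ℂ) := by
      apply Complex.ext
      · rw [Complex.ofReal_re]; linarith
      · rw [Complex.ofReal_im, him]
    refine ⟨?_, PsAbscissa.hasGradientAt_of_lineDeriv hαan.differentiableAt fun j => ?_, ?_⟩
    · rw [hs]; exact_mod_cast (neg_ne_zero.2 hDpos.ne')
    -- By the envelope theorem the entry is `-μ Re (u* A_j v)`, with `μ = 1/D` and `u* v = -D` real.
    · rw [(PsAbscissa.eventually_lineDeriv_eq_partialX hLY hY hαL hYst j).self_of_nhds, hYx,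
        PsAbscissa.partialX_lagrangian]
      beta_reduce
      rw [PsAbscissa.partialX_sigma
          (fun p q => (hAn p q).differentiableAt) (hσ D⁻¹).differentiableAt
          (by rw [PsAbscissa.sigma_mkY, hz.sigmaMin_eq]; exact hε) huv, hs,
        Complex.div_ofReal_re]
      have h2 : PsAbscissa.mkY z D⁻¹ 2 = D⁻¹ := rfl
      rw [h2, div_neg, neg_mul, div_eq_inv_mul]
    · rw [hs]
      push_cast
      rw [neg_div_neg_eq, one_div]
  · have h := PsAbscissa.hessian_eq_schur_complement hLY hY hαL hYst (by rw [hYx]; exact hu)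
    rw [hYx] at h
    exact h
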